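/- Let $V$ and $U$ be disjoint vertex sets with $|V|=n$ and $|U|=m$. Let $\boldsymbol{s}=(s_v)_{v\in V}$, $\boldsymbol{x}=(x_v)_{v\in V}$, $\boldsymbol{t}=(t_u)_{u\in U}$, $\boldsymbol{y}=(y_u)_{u\in U}$ be vectors of nonnegative integers with $$M_{st}:=\sum_{v\in V}s_v=\sum_{u\in U}t_u>10,\qquad M_{xy}:=\sum_{v\in V}x_v=\sum_{u\in U}y_u>10 .$$ Let $\operatorname{BP}(\boldsymbol{s},\boldsymbol{t},\boldsymbol{x},\boldsymbol{y})$ be the number of ordered pairs of edge-disjoint simple bipartite graphs with vertex classes $V,U$, the first with degrees $s_v$ ($v\in V$) and $t_u$ ($u\in U$), the second with degrees $x_v$ ($v\in V$) and $y_u$ ($u\in U$). Let $s_{\max},t_{\max},x_{\max},y_{\max}$ be the largest entries of the four vectors. Write $(a)_2=a(a-1)$ and put $S_2=\sum_v(s_v)_2$, $T_2=\sum_u(t_u)_2$, $X_2=\sum_v(x_v)_2$, $Y_2=\sum_u(y_u)_2$. For a vector $\boldsymbol{a}=(a_1,\dots,a_k)$ with average $\bar a=\frac1k\sum_i a_i$,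 let $c(\boldsymbol{a})=\sum_i|a_i-\bar a|$. Define $$\widehat F(\boldsymbol{s},\boldsymbol{t},\boldsymbol{x},\boldsymbol{y})=\frac{M_{st}!\,M_{xy}!}{\prod_{v\in V}s_v!\,x_v!\ \prod_{u\in U}t_u!\,y_u!}\exp\left(-\frac{S_2T_2}{2M_{st}^2}-\frac{X_2Y_2}{2M_{xy}^2}-\frac{\sum_{v\in V}s_vx_v\ \sum_{u\in U}t_uy_u}{M_{st}M_{xy}}\right),$$ $$\xi=\frac{(s_{\max}+t_{\max})^4}{M_{st}}+\frac{(s_{\max}+t_{\max})^2(x_{\max}+y_{\max})^2}{M_{st}}+\frac{(x_{\max}+y_{\max})^4}{M_{xy}},$$ $$\xi_s=\frac{c(\boldsymbol{s})\,t_{\max}\,x_{\max}}{M_{st}},\qquad \xi_t=\frac{c(\boldsymbol{t})\,s_{\max}\,y_{\max}}{M_{st}} .$$ **Theorem 3.1.** If $\xi=o(1)$, then $$\operatorname{BP}(\boldsymbol{s},\boldsymbol{t},\boldsymbol{x},\boldsymbol{y})=\widehat F(\boldsymbol{s},\boldsymbol{t},\boldsymbol{x},\boldsymbol{y})\,\exp\big(O(\xi+\min\{\xi_s,\xi_t\})\big).$$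 Here the asymptotic notation means the following: there are absolute constants $\varepsilon>0$ and $C>0$ such that, for all $n,m$ and all $\boldsymbol{s},\boldsymbol{t},\boldsymbol{x},\boldsymbol{y}$ as above with $\xi<\varepsilon$, there is a real number $\theta$ with $|\theta|\le C\,(\xi+\min\{\xi_s,\xi_t\})$ and $\operatorname{BP}(\boldsymbol{s},\boldsymbol{t},\boldsymbol{x},\boldsymbol{y})=\widehat F(\boldsymbol{s},\boldsymbol{t},\boldsymbol{x},\boldsymbol{y})\,e^{\theta}$. -/

import Mathlib

/-!
Bipartite pairs with prescribed degree sequences.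

The two vertex classes are `Fin n` (the class `V`) and `Fin m` (the class `U`), and a bipartite graph
over them is its set of edges, a finite set of pairs `(v, u)`.
-/

namespace BipPairs

/-- A (simple, labelled) bipartite graph with vertex classes `Fin n` and `Fin m`, as its edge set. -/
abbrev BipGraph (n m : ℕ) := Finset (Fin n × Fin m)

/-- The degree of the vertex `v` of the first class. -/
def degLeft {n m : ℕ} (G : BipGraph n m) (v : Fin n) : ℕ :=
  (G.filter (fun e => e.1 = v)).card

/-- The degree of the vertex `u` of the second class. -/
def degRight {n m : ℕ} (G : BipGraph n m) (u : Fin m) : ℕ :=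
  (G.filter (fun e => e.2 = u)).card

/-- `G` has bipartite degree sequence `(s, t)`. -/
def HasDegrees {n m : ℕ} (G : BipGraph n m) (s : Fin n → ℕ) (t : Fin m → ℕ) : Prop :=
  (∀ v, degLeft G v = s v) ∧ (∀ u, degRight G u = t u)

instance {n m : ℕ} (G : BipGraph n m) (s : Fin n → ℕ) (t : Fin m → ℕ) :
    Decidable (HasDegrees G s t) :=
  inferInstanceAs (Decidable (_ ∧ _))

/-- `BP s t x y`: the number of ordered pairs of edge-disjoint bipartite graphs on the same vertex
classes, the first with degree sequence `(s, t)`, the second with degree sequence `(x, y)`. -/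
def BP {n m : ℕ} (s : Fin n → ℕ) (t : Fin m → ℕ) (x : Fin n → ℕ) (y : Fin m → ℕ) : ℕ :=
  (Finset.univ.filter (fun p : BipGraph n m × BipGraph n m =>
    HasDegrees p.1 s t ∧ HasDegrees p.2 x y ∧ Disjoint p.1 p.2)).card

/-- The sum of the entries of a vector. -/
def total {k : ℕ} (a : Fin k → ℕ) : ℕ := ∑ i, a i

/-- The sum of the falling factorials `(a_i)_2 = a_i (a_i - 1)`. -/
def fallTwo {k : ℕ} (a : Fin k → ℕ) : ℕ := ∑ i, (a i).descFactorial 2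

/-- The largest entry of a vector (`0` for the empty vector). -/
def maxEntry {k : ℕ} (a : Fin k → ℕ) : ℕ := Finset.univ.sup a

/-- The average of the entries of a vector. -/
noncomputable def average {k : ℕ} (a : Fin k → ℕ) : ℝ := (∑ i, (a i : ℝ)) / (k : ℝ)

/-- The irregularity of a vector: the sum of the distances of its entries from their average. -/
noncomputable def irregularity {k : ℕ} (a : Fin k → ℕ) : ℝ := ∑ i, |(a i : ℝ) - average a|

/-- The standing conditions on the degree sequences: `M_st` and `M_xy` are well defined (both sides
of each bipartite graph have the same degree sum) and exceed `10`. -/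
structure Admissible {n m : ℕ} (s : Fin n → ℕ) (t : Fin m → ℕ) (x : Fin n → ℕ) (y : Fin m → ℕ) :
    Prop where
  sum_st : total s = total t
  sum_xy : total x = total y
  ten_lt_st : 10 < total s
  ten_lt_xy : 10 < total x

/-- The estimate for the number of bipartite pairs; `M_st = total s` and `M_xy = total x`. -/
noncomputable def FHat {n m : ℕ} (s : Fin n → ℕ) (t : Fin m → ℕ) (x : Fin n → ℕ) (y : Fin m → ℕ) :
    ℝ :=
  (((total s).factorial : ℝ) * ((total x).factorial : ℝ)) /
      ((∏ v, ((s v).factorial : ℝ) * ((x v).factorial : ℝ)) *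
        (∏ u, ((t u).factorial : ℝ) * ((y u).factorial : ℝ))) *
    Real.exp
      (-((fallTwo s : ℝ) * (fallTwo t : ℝ)) / (2 * (total s : ℝ) ^ 2)
        - ((fallTwo x : ℝ) * (fallTwo y : ℝ)) / (2 * (total x : ℝ) ^ 2)
        - ((∑ v, (s v : ℝ) * (x v : ℝ)) * (∑ u, (t u : ℝ) * (y u : ℝ))) /
            ((total s : ℝ) * (total x : ℝ)))

/-- The parameter `ξ`. -/
noncomputable def xi {n m : ℕ} (s : Fin n → ℕ) (t : Fin m → ℕ) (x : Fin n → ℕ) (y : Fin m → ℕ) :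
    ℝ :=
  ((maxEntry s : ℝ) + (maxEntry t : ℝ)) ^ 4 / (total s : ℝ)
    + ((maxEntry s : ℝ) + (maxEntry t : ℝ)) ^ 2 * ((maxEntry x : ℝ) + (maxEntry y : ℝ)) ^ 2
        / (total s : ℝ)
    + ((maxEntry x : ℝ) + (maxEntry y : ℝ)) ^ 4 / (total x : ℝ)

/-- The parameter `ξ_s`. -/
noncomputable def xiS {n m : ℕ} (s : Fin n → ℕ) (t : Fin m → ℕ) (x : Fin n → ℕ) : ℝ :=
  irregularity s * (maxEntry t : ℝ) * (maxEntry x : ℝ) / (total s : ℝ)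

/-- The parameter `ξ_t`. The denominator is `M_st`, here written as the sum of `s`. -/
noncomputable def xiT {n m : ℕ} (s : Fin n → ℕ) (t : Fin m → ℕ) (y : Fin m → ℕ) : ℝ :=
  irregularity t * (maxEntry s : ℝ) * (maxEntry y : ℝ) / (total s : ℝ)

end BipPairs

/-!
Split vertex `v` of one class into `s v` points and vertex `u` of the other into `t u` points,
giving `M` points on each side. A permutation of the `M` points projects to a bipartite
multigraph with degrees `(s, t)`, and every simple graph is the projection of exactly
`∏ s! · ∏ t!` permutations. So one counts the permutations that avoid the bad events: a forbidden
pair, lying over an edge of a given graph `H`, or two parallel edges. These are avoided one after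
the other: composing a permutation with a transposition shows that, among the permutations avoiding
the events treated so far, the next event has relative frequency close to `1 / M` or `1 / M²`,
so that avoiding all of them costs about a factor `exp (-∑ frequencies)`.

For the pairs of graphs, first choose the `(x, y)`-graph `H`, then an `(s, t)`-graph disjoint
from it. The estimate for the latter depends on `H` only through the sum of `s v * t u` over the
edges of `H`. The deviation of this sum from `(∑ s x) (∑ t y) / M_xy` is a covariance, and is
therefore controlled by the irregularity of `s` or of `t`.
-/

namespace BipPairs

open Finset Equiv
open scoped Nat

section ExpClose

/-- `A` approximates the nonnegative quantity `B` up to a factor between `exp (-ρ)` and `exp ρ`. -/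
def ExpClose (ρ A B : ℝ) : Prop := B * Real.exp (-ρ) ≤ A ∧ A ≤ B * Real.exp ρ

variable {ρ ρ' A B C : ℝ}

theorem ExpClose.trans (hAB : ExpClose ρ A B) (hBC : ExpClose ρ' B C) :
    ExpClose (ρ + ρ') A C := by
  constructor
  · calc C * Real.exp (-(ρ + ρ')) = C * Real.exp (-ρ') * Real.exp (-ρ) := by
          rw [mul_assoc, ← Real.exp_add]; ring_nf
      _ ≤ B * Real.exp (-ρ) := by gcongr; exact hBC.1
      _ ≤ A := hAB.1
  · calc A ≤ B * Real.exp ρ := hAB.2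
      _ ≤ C * Real.exp ρ' * Real.exp ρ := by gcongr; exact hBC.2
      _ = C * Real.exp (ρ + ρ') := by rw [mul_assoc, ← Real.exp_add, add_comm ρ]

theorem ExpClose.mono (hAB : ExpClose ρ A B) (hB : 0 ≤ B) (hρ : ρ ≤ ρ') : ExpClose ρ' A B :=
  ⟨le_trans (by gcongr) hAB.1, hAB.2.trans (by gcongr)⟩

theorem ExpClose.const_mul (hAB : ExpClose ρ A B) (hC : 0 ≤ C) :
    ExpClose ρ (C * A) (C * B) := by
  constructor
  · rw [mul_assoc]; gcongr; exact hAB.1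
  · rw [mul_assoc]; gcongr; exact hAB.2

theorem ExpClose.mul_const (hAB : ExpClose ρ A B) (hC : 0 ≤ C) :
    ExpClose ρ (A * C) (B * C) := by
  simpa only [mul_comm] using hAB.const_mul hC

theorem ExpClose.sum {ι : Type*} {S : Finset ι} {f : ι → ℝ} (hf : ∀ i ∈ S, ExpClose ρ (f i) B) :
    ExpClose ρ (∑ i ∈ S, f i) (#S * B) := by
  constructor
  · simpa [mul_assoc] using card_nsmul_le_sum S f _ fun i hi => (hf i hi).1
  · simpa [mul_assoc] using sum_le_card_nsmul S f _ fun i hi => (hf i hi).2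

theorem expClose_exp {u v : ℝ} (h : |u - v| ≤ ρ) : ExpClose ρ (Real.exp u) (Real.exp v) := by
  obtain ⟨h₁, h₂⟩ := abs_le.1 h
  constructor <;> rw [← Real.exp_add, Real.exp_le_exp] <;> linarith

theorem ExpClose.exists_eq_mul_exp (hAB : ExpClose ρ A B) (hB : 0 < B) :
    ∃ θ, |θ| ≤ ρ ∧ A = B * Real.exp θ := by
  have hA : 0 < A := lt_of_lt_of_le (by positivity) hAB.1
  refine ⟨Real.log (A / B), abs_le.2 ⟨?_, ?_⟩, ?_⟩
  · rw [Real.le_log_iff_exp_le (by positivity), le_div_iff₀ hB, mul_comm]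
    exact hAB.1
  · rw [Real.log_le_iff_le_exp (by positivity), div_le_iff₀ hB, mul_comm]
    exact hAB.2
  · rw [Real.exp_log (by positivity), mul_div_cancel₀ _ hB.ne']

end ExpClose

section Sieve

theorem exp_neg_le_one_sub {δ w : ℝ} (hw : 0 ≤ w) (hwδ : 3 * w ≤ δ) (hδ : 2 * δ ≤ 1) :
    Real.exp (-w) * Real.exp (-(2 * δ * w)) ≤ 1 - (1 + δ) * w := by
  set z := w + 2 * δ * w with hz
  have hδw : 0 ≤ δ * w := mul_nonneg (by linarith) hw
  have : 0 ≤ z := by linarith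
  have hexp : Real.exp (-z) ≤ (1 + z)⁻¹ := by
    rw [Real.exp_neg]
    exact inv_anti₀ (by linarith) (by linarith [Real.add_one_le_exp z])
  calc Real.exp (-w) * Real.exp (-(2 * δ * w)) = Real.exp (-z) := by
        rw [← Real.exp_add, hz]; ring_nf
    _ ≤ (1 + z)⁻¹ := hexp
    _ ≤ 1 - (1 + δ) * w := by
        rw [inv_le_iff_one_le_mul₀ (by linarith)]
        nlinarith [mul_le_mul_of_nonneg_right hwδ hw, mul_le_mul_of_nonneg_right hδ hδw,
          mul_le_mul_of_nonneg_right hδ hw, mul_nonneg hδw hw]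

theorem one_sub_le_exp_neg {δ w : ℝ} (hδw : 0 ≤ δ * w) :
    1 - (1 - δ) * w ≤ Real.exp (-w) * Real.exp (2 * δ * w) := by
  rw [← Real.exp_add]
  linarith [Real.add_one_le_exp (-w + 2 * δ * w)]

/-- Avoiding one event after the other: if, among the outcomes avoiding `F`, a further event `e`
always has relative frequency close to `w e`, then the frequencies `1 - w e` multiply up. -/
theorem expClose_of_insert {ι : Type*} [DecidableEq ι] (N : Finset ι → ℝ) (w : ι → ℝ) {δ : ℝ}
    (hδ : 2 * δ ≤ 1) (hN : ∀ F, 0 ≤ N F) {S : Finset ι} (hw : ∀ e ∈ S, 0 ≤ w e)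
    (hwδ : ∀ e ∈ S, 3 * w e ≤ δ)
    (hstep : ∀ F e, e ∉ F → insert e F ⊆ S →
      |N F - N (insert e F) - N F * w e| ≤ δ * (N F * w e)) :
    ExpClose (2 * δ * ∑ e ∈ S, w e) (N S) (N ∅ * Real.exp (-∑ e ∈ S, w e)) := by
  induction S using Finset.induction_on with
  | empty => simp [ExpClose]
  | insert e S he ih =>
    have hwe := hw e (mem_insert_self e S)
    have hweδ := hwδ e (mem_insert_self e S)
    have ih := ih (fun e' h => hw e' (mem_insert_of_mem h))
      (fun e' h => hwδ e' (mem_insert_of_mem h))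
      (fun F e' he' hF => hstep F e' he' (hF.trans (subset_insert e S)))
    have hnext : ExpClose (2 * δ * w e) (N (insert e S)) (N S * Real.exp (-w e)) := by
      obtain ⟨h₁, h₂⟩ := abs_le.1 (hstep S e he Subset.rfl)
      constructor
      · calc N S * Real.exp (-w e) * Real.exp (-(2 * δ * w e))
            = N S * (Real.exp (-w e) * Real.exp (-(2 * δ * w e))) := mul_assoc _ _ _
          _ ≤ N S * (1 - (1 + δ) * w e) := by
              gcongr
              · exact hN S
              · exact exp_neg_le_one_sub hwe hweδ hδ
          _ ≤ N (insert e S) := by linarith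
      · calc N (insert e S) ≤ N S * (1 - (1 - δ) * w e) := by linarith
          _ ≤ N S * (Real.exp (-w e) * Real.exp (2 * δ * w e)) := by
              gcongr
              · exact hN S
              · exact one_sub_le_exp_neg (mul_nonneg (by linarith) hwe)
          _ = N S * Real.exp (-w e) * Real.exp (2 * δ * w e) := (mul_assoc _ _ _).symm
    convert hnext.trans (ih.mul_const (Real.exp_nonneg (-w e))) using 1
    · rw [sum_insert he, mul_add]
    · rw [sum_insert he, mul_assoc, ← Real.exp_add, neg_add_rev]

end Sieve

section Events

variable {α V U : Type*} [DecidableEq V] [DecidableEq U] [DecidableEq α] [Fintype α]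

/-- The permutations whose graph contains the pairs in `R` and no event in `F`. An event is an
unordered pair of points of `α × α`, and it occurs when both of its points are on the graph; an
event on the diagonal thus prescribes a single value of the permutation. -/
def pinned (F : Finset (Sym2 (α × α))) (R : Finset (α × α)) : Finset (Perm α) :=
  {σ | (∀ x ∈ R, σ x.1 = x.2) ∧ ∀ x y, s(x, y) ∈ F → σ x.1 = x.2 → σ y.1 ≠ y.2}

/-- Two pairs of points are adjacent if a permutation with both on its graph would produce a
repeated edge when its graph is projected along `a` and `b`. -/
def parallelGraph (a : α → V) (b : α → U) : SimpleGraph (α × α) where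
  Adj x y := x.1 ≠ y.1 ∧ x.2 ≠ y.2 ∧ Prod.map a b x = Prod.map a b y
  symm := ⟨fun _ _ h => ⟨h.1.symm, h.2.1.symm, h.2.2.symm⟩⟩
  loopless := ⟨fun _ h => h.1 rfl⟩

instance (a : α → V) (b : α → U) : DecidableRel (parallelGraph a b).Adj :=
  fun _ _ => inferInstanceAs (Decidable (_ ∧ _ ∧ _))

/-- The events that a permutation has to avoid for its projection along `a` and `b` to be simple
and to avoid the edges under the set `J` of forbidden pairs. Parallel pairs in `J` are left out,
as they occur only if a forbidden pair does. -/
def badEvents (a : α → V) (b : α → U) (J : Finset (α × α)) : Finset (Sym2 (α × α)) :=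
  J.image Sym2.diag ∪ {e ∈ (parallelGraph a b).edgeFinset | ∀ x ∈ e, x ∉ J}

/-- Bounds for the sizes of the fibres of `a` and `b` and of the rows and columns of `J`. -/
structure LocalBounds (a : α → V) (b : α → U) (J : Finset (α × α)) (Δ h : ℕ) : Prop where
  left : ∀ v, #{p | a p = v} ≤ Δ
  right : ∀ u, #{q | b q = u} ≤ Δ
  row : ∀ p, #{q | (p, q) ∈ J} ≤ h
  col : ∀ q, #{p | (p, q) ∈ J} ≤ h

variable {a : α → V} {b : α → U} {J : Finset (α × α)} {Δ h : ℕ}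
  {F : Finset (Sym2 (α × α))} {R : Finset (α × α)} {σ : Perm α} {x y z : α × α}

theorem mem_pinned : σ ∈ pinned F R ↔
    (∀ x ∈ R, σ x.1 = x.2) ∧ ∀ x y, s(x, y) ∈ F → σ x.1 = x.2 → σ y.1 ≠ y.2 := by
  simp [pinned]

theorem mem_pinned_insert : σ ∈ pinned F (insert z R) ↔ σ ∈ pinned F R ∧ σ z.1 = z.2 := by
  simp only [mem_pinned, forall_mem_insert]
  tauto

theorem mk_mem_badEvents : s(x, y) ∈ badEvents a b J ↔
    (x = y ∧ x ∈ J) ∨ ((parallelGraph a b).Adj x y ∧ x ∉ J ∧ y ∉ J) := by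
  simp only [badEvents, mem_union, mem_image, mem_filter, SimpleGraph.mem_edgeFinset,
    SimpleGraph.mem_edgeSet, Sym2.mem_iff, forall_eq_or_imp, forall_eq]
  refine or_congr_left ⟨?_, ?_⟩
  · rintro ⟨z, hz, hzxy⟩
    obtain ⟨rfl, rfl⟩ | ⟨rfl, rfl⟩ := Sym2.eq_iff.1 (show s(z, z) = s(x, y) from hzxy) <;>
      exact ⟨rfl, hz⟩
  · rintro ⟨rfl, hx⟩
    exact ⟨x, hx, rfl⟩

theorem mem_or_adj_of_mem (hF : F ⊆ badEvents a b J) (hxy : s(x, y) ∈ F) :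
    (x = y ∧ x ∈ J) ∨ (parallelGraph a b).Adj x y :=
  (mk_mem_badEvents.1 (hF hxy)).imp_right And.left

theorem diag_notMem_of_notMem (hF : F ⊆ badEvents a b J) (hz : z ∉ J) : s(z, z) ∉ F := fun h =>
  (mk_mem_badEvents.1 (hF h)).elim (fun h => hz h.2) fun h => h.1.ne rfl

theorem card_pinned_insert_add (F : Finset (Sym2 (α × α))) (e : Sym2 (α × α)) :
    #(pinned (insert e F) ∅) + #(pinned F e.toFinset) = #(pinned F ∅) := by
  induction e using Sym2.ind with | _ x y => ?_
  rw [← card_filter_add_card_filter_not (s := pinned F ∅) fun σ => σ x.1 = x.2 ∧ σ y.1 = y.2,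
    add_comm]
  congr 2
  · ext σ
    simp only [Sym2.toFinset_mk_eq, mem_filter, mem_pinned, mem_insert, mem_singleton,
      forall_eq_or_imp, forall_eq, notMem_empty, false_imp_iff, implies_true, true_and]
    tauto
  · ext σ
    simp only [mem_filter, mem_pinned, mem_insert, Sym2.eq_iff,
      notMem_empty, false_imp_iff, implies_true, true_and]
    constructor
    · intro hσ
      exact ⟨fun x' y' h => hσ x' y' (.inr h), fun h => hσ x y (.inl (.inl ⟨rfl, rfl⟩)) h.1 h.2⟩
    · rintro ⟨hF, hxy⟩ x' y' ((⟨rfl, rfl⟩ | ⟨rfl, rfl⟩) | h) hx hy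
      · exact hxy ⟨hx, hy⟩
      · exact hxy ⟨hy, hx⟩
      · exact hF x' y' h hx hy

theorem LocalBounds.card_filter_map_eq_le (hb : LocalBounds a b J Δ h) (c : V × U) :
    #{y : α × α | Prod.map a b y = c} ≤ Δ ^ 2 := by
  have : ({y : α × α | Prod.map a b y = c} : Finset (α × α)) =
      ({p | a p = c.1} : Finset α) ×ˢ ({q | b q = c.2} : Finset α) := by
    ext y
    simp [Prod.ext_iff]
  rw [this, card_product, sq]
  exact Nat.mul_le_mul (hb.left _) (hb.right _)

theorem LocalBounds.card_le (hb : LocalBounds a b J Δ h) : #J ≤ Fintype.card α * h := by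
  have hrow (p : α) : #{x ∈ J | x.1 = p} ≤ #{q | (p, q) ∈ J} := by
    refine card_le_card_of_injOn Prod.snd (fun x hx => ?_) fun x hx y hy hxy => ?_
    · obtain ⟨hxJ, rfl⟩ := mem_filter.1 hx
      exact mem_filter.2 ⟨mem_univ _, hxJ⟩
    · exact Prod.ext ((mem_filter.1 hx).2.trans (mem_filter.1 hy).2.symm) hxy
  rw [mul_comm, ← card_univ]
  exact card_le_mul_card_image_of_maps_to (f := Prod.fst) (fun _ _ => mem_univ _) h
    fun p _ => (hrow p).trans (hb.row p)

end Events

section Switching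

theorem card_filter_exists_fibre_le {α X Y : Type*} [Fintype α] [DecidableEq X] [DecidableEq Y]
    {Δ : ℕ} {f : α → X} {g : α → Y} (hf : ∀ c, #{p | f p = c} ≤ Δ) (hg : ∀ c, #{p | g p = c} ≤ Δ)
    (c : X) : #{p | ∃ p₂, f p₂ = c ∧ g p₂ = g p} ≤ Δ ^ 2 := by
  classical
  have hsub : ({p | ∃ p₂, f p₂ = c ∧ g p₂ = g p} : Finset α) ⊆
      ({p₂ | f p₂ = c} : Finset α).biUnion fun p₂ => {p | g p = g p₂} := by
    intro p hp
    simpa [eq_comm] using hp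
  calc #{p | ∃ p₂, f p₂ = c ∧ g p₂ = g p} ≤ _ := card_le_card hsub
    _ ≤ #{p₂ | f p₂ = c} * Δ := card_biUnion_le_card_mul _ _ _ fun p₂ _ => hg _
    _ ≤ Δ ^ 2 := by rw [sq]; exact Nat.mul_le_mul_right _ (hf c)

variable {α V U : Type*} [DecidableEq α] [Fintype α] {F : Finset (Sym2 (α × α))}
  {R : Finset (α × α)} {σ : Perm α} {z : α × α}

theorem mul_swap_mem_pinned {R' : Finset (α × α)} {p p' : α} (hσ : σ ∈ pinned F R)
    (hR' : ∀ x ∈ R', (σ * swap p p') x.1 = x.2)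
    (hp : ∀ y, s((p, σ p'), y) ∈ F → (σ * swap p p') y.1 ≠ y.2)
    (hp' : ∀ y, s((p', σ p), y) ∈ F → (σ * swap p p') y.1 ≠ y.2) :
    σ * swap p p' ∈ pinned F R' := by
  have hgraph (x : α × α) (hx : (σ * swap p p') x.1 = x.2) :
      x = (p, σ p') ∨ x = (p', σ p) ∨ σ x.1 = x.2 := by
    obtain ⟨x₁, x₂⟩ := x
    obtain rfl | h₁ := eq_or_ne x₁ p
    · exact .inl (by simpa using hx.symm)
    obtain rfl | h₂ := eq_or_ne x₁ p'
    · exact .inr (.inl (by simpa using hx.symm))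
    · exact .inr (.inr (by simpa [swap_apply_of_ne_of_ne h₁ h₂] using hx))
  refine mem_pinned.2 ⟨hR', fun x y hxy hx hy => ?_⟩
  obtain rfl | rfl | hσx := hgraph x hx
  · exact hp y hxy hy
  · exact hp' y hxy hy
  obtain rfl | rfl | hσy := hgraph y hy
  · exact hp x (Sym2.eq_swap ▸ hxy) hx
  · exact hp' x (Sym2.eq_swap ▸ hxy) hx
  · exact (mem_pinned.1 hσ).2 x y hxy hσx hσy

/-- Switching `z` out of a permutation is undone by switching `z` back in, and the point used for
the switching can be read off the result. -/
theorem sum_card_switch_eq {A : Finset (Perm α)} (hA : ∀ σ ∈ A, σ z.1 = z.2)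
    (B : Finset (Perm α)) :
    ∑ σ ∈ A, #{p' | σ * swap z.1 p' ∈ B} =
      #{τ ∈ B | τ * swap z.1 (τ.symm z.2) ∈ A} := by
  rw [← card_sigma]
  refine card_nbij' (fun x => x.1 * swap z.1 x.2)
    (fun τ => ⟨τ * swap z.1 (τ.symm z.2), τ.symm z.2⟩) ?_ ?_ ?_ ?_
  · rintro ⟨σ, p'⟩ hx
    obtain ⟨hσ, hB⟩ := mem_sigma.1 hx
    have hp' : (σ * swap z.1 p').symm z.2 = p' := by simp [symm_apply_eq, hA σ hσ]
    simp only [coe_filter, Set.mem_ofPred_eq, hp', mul_assoc, swap_mul_self, mul_one]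
    exact ⟨(mem_filter.1 hB).2, hσ⟩
  · intro τ hτ
    obtain ⟨hB, hA⟩ := mem_filter.1 hτ
    exact mem_sigma.2 ⟨hA, by simpa [mul_assoc] using hB⟩
  · rintro ⟨σ, p'⟩ hx
    have hp' : (σ * swap z.1 p').symm z.2 = p' := by
      simp [symm_apply_eq, hA σ (mem_sigma.1 hx).1]
    simp [hp', mul_assoc]
  · intro τ _
    simp [mul_assoc]

variable [DecidableEq V] [DecidableEq U] {a : α → V} {b : α → U} {J : Finset (α × α)} {Δ h : ℕ}

theorem mul_swap_mem_pinned_of_insert (hF : F ⊆ badEvents a b J) (hz : z ∉ R)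
    (hσ : σ ∈ pinned F (insert z R)) {p' : α} (hR : p' ∉ R.image Prod.fst)
    (hrow : (z.1, σ p') ∉ J) (hcol : (p', z.2) ∉ J)
    (hleft : ¬∃ p₂, a p₂ = a z.1 ∧ b (σ p₂) = b (σ p'))
    (hright : ¬∃ p₂, b (σ p₂) = b z.2 ∧ a p₂ = a p') :
    σ * swap z.1 p' ∈ pinned F R := by
  obtain ⟨hσR, hσz⟩ := mem_pinned_insert.1 hσ
  obtain ⟨p, q⟩ := z
  obtain rfl : σ p = q := hσz
  push Not at hleft hright
  refine mul_swap_mem_pinned hσR (fun x hx => ?_) (fun y hpy hy => ?_) (fun y hpy hy => ?_)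
  · have hσx := (mem_pinned.1 hσR).1 x hx
    have hxp : x.1 ≠ p := by
      rintro rfl
      exact hz (by rwa [hσx])
    have hxp' : x.1 ≠ p' := by
      rintro rfl
      exact hR (mem_image_of_mem _ hx)
    simpa [swap_apply_of_ne_of_ne hxp hxp'] using hσx
  · obtain ⟨-, hJ⟩ | ⟨hne, -, hcells⟩ := mem_or_adj_of_mem hF hpy
    · exact hrow hJ
    obtain ⟨ha, hb⟩ := Prod.ext_iff.1 hcells
    obtain hyp' | hyp' := eq_or_ne y.1 p'
    · rw [hyp', Perm.mul_apply, swap_apply_right] at hy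
      exact hleft p rfl (by rw [hy]; exact hb.symm)
    · rw [Perm.mul_apply, swap_apply_of_ne_of_ne (Ne.symm hne) hyp'] at hy
      exact hleft y.1 ha.symm (by rw [hy]; exact hb.symm)
  · obtain ⟨-, hJ⟩ | ⟨hne, -, hcells⟩ := mem_or_adj_of_mem hF hpy
    · exact hcol hJ
    obtain ⟨ha, hb⟩ := Prod.ext_iff.1 hcells
    obtain hyp | hyp := eq_or_ne y.1 p
    · exact hright p rfl (by simpa [hyp] using ha.symm)
    · rw [Perm.mul_apply, swap_apply_of_ne_of_ne hyp (Ne.symm hne)] at hy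
      exact hright y.1 (by rw [hy]; exact hb.symm) ha.symm

theorem card_filter_mul_swap_notMem_le (hF : F ⊆ badEvents a b J) (hb : LocalBounds a b J Δ h)
    (hz : z ∉ R) (hσ : σ ∈ pinned F (insert z R)) :
    #{p' | σ * swap z.1 p' ∉ pinned F R} ≤ #R + 2 * h + 2 * Δ ^ 2 := by
  have hsub : ({p' | σ * swap z.1 p' ∉ pinned F R} : Finset α) ⊆
      R.image Prod.fst ∪ ({p' | (z.1, σ p') ∈ J} : Finset α) ∪
        ({p' | (p', z.2) ∈ J} : Finset α) ∪
        ({p' | ∃ p₂, a p₂ = a z.1 ∧ b (σ p₂) = b (σ p')} : Finset α) ∪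
        ({p' | ∃ p₂, b (σ p₂) = b z.2 ∧ a p₂ = a p'} : Finset α) := by
    intro p' hp'
    by_contra hgood
    simp only [mem_union, mem_filter, mem_univ, true_and, not_or] at hgood hp'
    obtain ⟨⟨⟨⟨hR, hrow⟩, hcol⟩, hleft⟩, hright⟩ := hgood
    exact hp' (mul_swap_mem_pinned_of_insert hF hz hσ hR hrow hcol hleft hright)
  have hbσ (u : U) : #{p | b (σ p) = u} ≤ Δ := (card_equiv σ (by simp)).trans_le (hb.right u)
  calc #{p' | σ * swap z.1 p' ∉ pinned F R} ≤ _ := card_le_card hsub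
    _ ≤ #R + h + h + Δ ^ 2 + Δ ^ 2 := by
        iterate 4 refine (card_union_le _ _).trans (Nat.add_le_add ?_ ?_)
        · exact card_image_le
        · exact (card_equiv σ (by simp)).trans_le (hb.row z.1)
        · exact hb.col z.2
        · exact card_filter_exists_fibre_le hb.left hbσ _
        · exact card_filter_exists_fibre_le hbσ hb.left _
    _ = #R + 2 * h + 2 * Δ ^ 2 := by ring

theorem card_pinned_insert_mul_le (hF : F ⊆ badEvents a b J) (hb : LocalBounds a b J Δ h)
    (hz : z ∉ R) :
    (#(pinned F (insert z R)) : ℝ) * (Fintype.card α - (#R + 2 * h + 2 * Δ ^ 2)) ≤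
      #(pinned F R) := by
  have hgood : ∀ σ ∈ pinned F (insert z R),
      (Fintype.card α - (#R + 2 * h + 2 * Δ ^ 2) : ℝ) ≤ #{p' | σ * swap z.1 p' ∈ pinned F R} := by
    intro σ hσ
    have hbad := card_filter_mul_swap_notMem_le hF hb hz hσ
    have hsum := card_filter_add_card_filter_not (s := univ) (σ * swap z.1 · ∈ pinned F R)
    rw [card_univ] at hsum
    rify at hbad hsum
    linarith
  calc _ ≤ ∑ σ ∈ pinned F (insert z R), (#{p' | σ * swap z.1 p' ∈ pinned F R} : ℝ) := by
        simpa using card_nsmul_le_sum _ _ _ hgood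
    _ = #{τ ∈ pinned F R | τ * swap z.1 (τ.symm z.2) ∈ pinned F (insert z R)} := by
        rw [← sum_card_switch_eq fun _ hσ => (mem_pinned_insert.1 hσ).2, Nat.cast_sum]
    _ ≤ #(pinned F R) := by gcongr; exact filter_subset _ _

theorem card_pinned_union_le (hF : F ⊆ badEvents a b J) (hb : LocalBounds a b J Δ h)
    {S : Finset (α × α)} (hSR : Disjoint S R)
    (hM : 2 * (#S + #R + 2 * h + 2 * Δ ^ 2) ≤ Fintype.card α) :
    (#(pinned F (S ∪ R)) : ℝ) ≤ (2 / Fintype.card α) ^ #S * #(pinned F R) := by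
  induction S using Finset.induction_on with
  | empty => simp
  | insert z S hzS ih =>
    rw [disjoint_insert_left] at hSR
    rw [card_insert_of_notMem hzS] at hM ⊢
    have hz : z ∉ S ∪ R := by simp [hzS, hSR.1]
    have hinsert := card_pinned_insert_mul_le hF hb hz
    have hunion := card_union_le S R
    have hM₀ : (0 : ℝ) < Fintype.card α := by
      exact_mod_cast Fintype.card_pos_iff.2 ⟨z.1⟩
    have hhalf : (#(pinned F (insert z (S ∪ R))) : ℝ) * Fintype.card α ≤
        2 * #(pinned F (S ∪ R)) := by
      rify at hM hunion
      nlinarith [Nat.cast_nonneg (α := ℝ) #(pinned F (insert z (S ∪ R)))]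
    rw [insert_union]
    calc (#(pinned F (insert z (S ∪ R))) : ℝ) ≤ 2 / Fintype.card α * #(pinned F (S ∪ R)) := by
          rwa [div_mul_eq_mul_div, le_div_iff₀ hM₀]
      _ ≤ 2 / Fintype.card α * ((2 / Fintype.card α) ^ #S * #(pinned F R)) := by
          gcongr
          exact ih hSR.2 (by omega)
      _ = _ := by rw [pow_succ']; ring

theorem card_filter_exists_pinned_le (hF : F ⊆ badEvents a b J) (hb : LocalBounds a b J Δ h)
    {ι : Type*} (I : Finset ι) (S : ι → Finset (α × α)) {k : ℕ} (hk : ∀ i ∈ I, #(S i) = k)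
    (hSR : ∀ i ∈ I, Disjoint (S i) R)
    (hM : 2 * (k + #R + 2 * h + 2 * Δ ^ 2) ≤ Fintype.card α) :
    (#{σ ∈ pinned F R | ∃ i ∈ I, ∀ x ∈ S i, σ x.1 = x.2} : ℝ) ≤
      #I * (2 / Fintype.card α) ^ k * #(pinned F R) := by
  have hsub : {σ ∈ pinned F R | ∃ i ∈ I, ∀ x ∈ S i, σ x.1 = x.2} ⊆
      I.biUnion fun i => pinned F (S i ∪ R) := by
    intro σ hσ
    obtain ⟨hσ, i, hi, hx⟩ := mem_filter.1 hσ
    rw [mem_pinned] at hσ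
    exact mem_biUnion.2 ⟨i, hi, mem_pinned.2
      ⟨fun x hxS => (mem_union.1 hxS).elim (hx x) (hσ.1 x), hσ.2⟩⟩
  calc (#{σ ∈ pinned F R | ∃ i ∈ I, ∀ x ∈ S i, σ x.1 = x.2} : ℝ)
      ≤ ∑ i ∈ I, (#(pinned F (S i ∪ R)) : ℝ) := by
        exact_mod_cast (card_le_card hsub).trans card_biUnion_le
    _ ≤ ∑ _i ∈ I, (2 / Fintype.card α : ℝ) ^ k * #(pinned F R) := by
        gcongr with i hi
        rw [← hk i hi]
        exact card_pinned_union_le hF hb (hSR i hi) (by rwa [hk i hi])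
    _ = _ := by rw [sum_const, nsmul_eq_mul, mul_assoc]

theorem exists_conflict_of_mul_swap_notMem (hF : F ⊆ badEvents a b J)
    (hzF : ∀ r ∈ insert z R, s(z, r) ∉ F) (hzR : ∀ r ∈ R, r.1 ≠ z.1 ∧ r.2 ≠ z.2)
    (hσ : σ ∈ pinned F R)
    (hbad : σ * swap z.1 (σ.symm z.2) ∉ pinned F (insert z R)) :
    (∃ y ∉ R, Prod.map a b y = Prod.map a b z ∧ σ y.1 = y.2) ∨
    (σ.symm z.2, σ z.1) ∈ J ∨
    (∃ r ∈ R, Prod.map a b (σ.symm z.2, σ z.1) = Prod.map a b r) ∨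
    ∃ y ∉ R, y.1 ≠ z.1 ∧ y.1 ≠ σ.symm z.2 ∧
      Prod.map a b y = Prod.map a b (σ.symm z.2, σ z.1) ∧ σ y.1 = y.2 := by
  obtain ⟨p, q⟩ := z
  set p' := σ.symm q
  have hσp' : σ p' = q := σ.apply_symm_apply q
  have hpR : (p, σ p) ∉ R := fun h => (hzR _ h).1 rfl
  by_contra! hgood
  obtain ⟨hcells, hJ, hR, hthird⟩ := hgood
  refine hbad (mul_swap_mem_pinned hσ ?_ (fun y hpy hy => ?_) fun y hpy hy => ?_)
  · rw [forall_mem_insert]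
    refine ⟨by simpa using hσp', fun x hx => ?_⟩
    have hσx := (mem_pinned.1 hσ).1 x hx
    have hxp' : x.1 ≠ p' := fun h => (hzR x hx).2 (by rw [← hσx, h, hσp'])
    simpa [swap_apply_of_ne_of_ne (hzR x hx).1 hxp'] using hσx
  · rw [hσp'] at hpy
    obtain ⟨rfl, -⟩ | ⟨hne, -, hmap⟩ := mem_or_adj_of_mem hF hpy
    · exact hzF _ (mem_insert_self _ _) hpy
    obtain hyp' | hyp' := eq_or_ne y.1 p'
    · rw [hyp', Perm.mul_apply, swap_apply_right] at hy
      exact hcells (p, σ p) hpR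
        (Prod.ext rfl ((congrArg b hy).trans (congrArg Prod.snd hmap.symm))) rfl
    · rw [Perm.mul_apply, swap_apply_of_ne_of_ne (Ne.symm hne) hyp'] at hy
      exact hcells y (fun h => hzF y (mem_insert_of_mem h) hpy) hmap.symm hy
  · obtain ⟨-, hwJ⟩ | ⟨hne, -, hmap⟩ := mem_or_adj_of_mem hF hpy
    · exact hJ hwJ
    obtain hyp | hyp := eq_or_ne y.1 p
    · rw [hyp, Perm.mul_apply, swap_apply_left, hσp'] at hy
      exact hcells (p, σ p) hpR
        (Prod.ext rfl ((congrArg Prod.snd hmap).trans (congrArg b hy.symm))) rfl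
    · rw [Perm.mul_apply, swap_apply_of_ne_of_ne hyp (Ne.symm hne)] at hy
      exact hthird y (fun h => hR y h hmap) hyp (Ne.symm hne) hmap.symm hy

theorem card_filter_exists_over_le (hF : F ⊆ badEvents a b J) (hb : LocalBounds a b J Δ h)
    (hM : 2 * (1 + #R + 2 * h + 2 * Δ ^ 2) ≤ Fintype.card α) (c : V × U) :
    (#{σ ∈ pinned F R | ∃ y ∉ R, Prod.map a b y = c ∧ σ y.1 = y.2} : ℝ) ≤
      Δ ^ 2 * (2 / Fintype.card α) * #(pinned F R) := by
  let I : Finset (α × α) := {y | y ∉ R ∧ Prod.map a b y = c}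
  have hI : (#I : ℝ) ≤ Δ ^ 2 := by
    exact_mod_cast (card_le_card (monotone_filter_right _ fun y _ (h : y ∉ R ∧ _) => h.2)).trans
      (hb.card_filter_map_eq_le c)
  calc _ = (#{σ ∈ pinned F R | ∃ y ∈ I, ∀ x ∈ ({y} : Finset (α × α)), σ x.1 = x.2} : ℝ) := by
        simp [I, and_assoc]
    _ ≤ #I * (2 / Fintype.card α) ^ 1 * #(pinned F R) :=
        card_filter_exists_pinned_le hF hb I _ (fun y _ => card_singleton y)
          (fun y hy => disjoint_singleton_left.2 (mem_filter.1 hy).2.1) hM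
    _ ≤ Δ ^ 2 * (2 / Fintype.card α) * #(pinned F R) := by rw [pow_one]; gcongr

theorem card_filter_displaced_mem_le (hF : F ⊆ badEvents a b J) (hb : LocalBounds a b J Δ h)
    (hM : 2 * (2 + #R + 2 * h + 2 * Δ ^ 2) ≤ Fintype.card α)
    (hzR : ∀ r ∈ R, r.1 ≠ z.1 ∧ r.2 ≠ z.2) (W : Finset (α × α)) :
    (#{σ ∈ pinned F R | σ z.1 ≠ z.2 ∧ (σ.symm z.2, σ z.1) ∈ W} : ℝ) ≤
      #W * (2 / Fintype.card α) ^ 2 * #(pinned F R) := by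
  let I : Finset (α × α) := {w ∈ W | w.1 ≠ z.1}
  have hsub : {σ ∈ pinned F R | σ z.1 ≠ z.2 ∧ (σ.symm z.2, σ z.1) ∈ W} ⊆
      {σ ∈ pinned F R | ∃ w ∈ I, ∀ x ∈ ({(z.1, w.2), (w.1, z.2)} : Finset (α × α)),
        σ x.1 = x.2} := by
    refine monotone_filter_right _ fun σ _ ⟨hσz, hW⟩ => ?_
    exact ⟨_, mem_filter.2 ⟨hW, mt σ.symm_apply_eq.1 hσz.symm⟩, by simp⟩
  calc _ ≤ (#{σ ∈ pinned F R | ∃ w ∈ I, ∀ x ∈ ({(z.1, w.2), (w.1, z.2)} : Finset (α × α)),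
        σ x.1 = x.2} : ℝ) := by exact_mod_cast card_le_card hsub
    _ ≤ #I * (2 / Fintype.card α) ^ 2 * #(pinned F R) := by
        refine card_filter_exists_pinned_le hF hb I _ (fun w hw => ?_) (fun w _ => ?_) hM
        · exact card_pair fun h => (mem_filter.1 hw).2 (congrArg Prod.fst h).symm
        · simp only [disjoint_insert_left, disjoint_singleton_left]
          exact ⟨fun h => (hzR _ h).1 rfl, fun h => (hzR _ h).2 rfl⟩
    _ ≤ #W * (2 / Fintype.card α) ^ 2 * #(pinned F R) := by gcongr; exact filter_subset _ _

theorem card_filter_displaced_parallel_le (hF : F ⊆ badEvents a b J) (hb : LocalBounds a b J Δ h)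
    (hM : 2 * (3 + #R + 2 * h + 2 * Δ ^ 2) ≤ Fintype.card α)
    (hzR : ∀ r ∈ R, r.1 ≠ z.1 ∧ r.2 ≠ z.2) :
    (#{σ ∈ pinned F R | σ z.1 ≠ z.2 ∧ ∃ y ∉ R, y.1 ≠ z.1 ∧ y.1 ≠ σ.symm z.2 ∧
      Prod.map a b y = Prod.map a b (σ.symm z.2, σ z.1) ∧ σ y.1 = y.2} : ℝ) ≤
      Fintype.card α ^ 2 * Δ ^ 2 * (2 / Fintype.card α) ^ 3 * #(pinned F R) := by
  let I : Finset ((α × α) × (α × α)) := {i | i.1.1 ≠ z.1 ∧ i.2 ∉ R ∧ i.2.1 ≠ z.1 ∧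
    i.2.1 ≠ i.1.1 ∧ Prod.map a b i.2 = Prod.map a b i.1}
  let S (i : (α × α) × (α × α)) : Finset (α × α) := {i.2, (z.1, i.1.2), (i.1.1, z.2)}
  have hI : #I ≤ Fintype.card α ^ 2 * Δ ^ 2 := by
    rw [sq (Fintype.card α), ← Fintype.card_prod, ← card_univ, mul_comm]
    refine card_le_mul_card_image_of_maps_to (f := Prod.fst) (fun _ _ => mem_univ _) _
      fun w _ => (card_le_card_of_injOn Prod.snd (fun i hi => ?_) fun i hi j hj hij => ?_).trans
        (hb.card_filter_map_eq_le (Prod.map a b w))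
    · obtain ⟨hiI, rfl⟩ := mem_filter.1 hi
      exact mem_filter.2 ⟨mem_univ _, (mem_filter.1 hiI).2.2.2.2.2⟩
    · exact Prod.ext ((mem_filter.1 hi).2.trans (mem_filter.1 hj).2.symm) hij
  calc _ ≤ (#{σ ∈ pinned F R | ∃ i ∈ I, ∀ x ∈ S i, σ x.1 = x.2} : ℝ) := by
        refine Nat.cast_le.2 (card_le_card (monotone_filter_right _ ?_))
        rintro σ - ⟨hσz, y, hyR, hyz, hyw, hmap, hσy⟩
        exact ⟨((σ.symm z.2, σ z.1), y), mem_filter.2 ⟨mem_univ _,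
          mt σ.symm_apply_eq.1 hσz.symm, hyR, hyz, hyw, hmap⟩, by simp [S, hσy]⟩
    _ ≤ #I * (2 / Fintype.card α) ^ 3 * #(pinned F R) := by
        refine card_filter_exists_pinned_le hF hb I S (fun i hi => ?_) (fun i hi => ?_) hM <;>
          obtain ⟨-, hwz, hyR, hyz, hyw, -⟩ := mem_filter.1 hi
        · exact card_eq_three.2 ⟨i.2, (z.1, i.1.2), (i.1.1, z.2),
            fun h => hyz (by rw [h]),
            fun h => hyw (by rw [h]), fun h => hwz (congrArg Prod.fst h).symm, rfl⟩
        · simp only [S, disjoint_insert_left, disjoint_singleton_left]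
          exact ⟨hyR, fun h => (hzR _ h).1 rfl, fun h => (hzR _ h).2 rfl⟩
    _ ≤ Fintype.card α ^ 2 * Δ ^ 2 * (2 / Fintype.card α) ^ 3 * #(pinned F R) := by
        gcongr
        exact_mod_cast hI

theorem filter_mul_swap_symm_notMem_subset (hF : F ⊆ badEvents a b J)
    (hzF : ∀ r ∈ insert z R, s(z, r) ∉ F) (hzR : ∀ r ∈ R, r.1 ≠ z.1 ∧ r.2 ≠ z.2) :
    {σ ∈ pinned F R | σ * swap z.1 (σ.symm z.2) ∉ pinned F (insert z R)} ⊆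
      {σ ∈ pinned F R | ∃ y ∉ R, Prod.map a b y = Prod.map a b z ∧ σ y.1 = y.2} ∪
      {σ ∈ pinned F R | σ z.1 ≠ z.2 ∧ (σ.symm z.2, σ z.1) ∈
        J ∪ R.biUnion fun r => {w | Prod.map a b w = Prod.map a b r}} ∪
      {σ ∈ pinned F R | σ z.1 ≠ z.2 ∧ ∃ y ∉ R, y.1 ≠ z.1 ∧ y.1 ≠ σ.symm z.2 ∧
        Prod.map a b y = Prod.map a b (σ.symm z.2, σ z.1) ∧ σ y.1 = y.2} := by
  intro σ hσ
  obtain ⟨hσ, hbad⟩ := mem_filter.1 hσ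
  have hσz : σ z.1 ≠ z.2 := fun h =>
    hbad (by rw [← h, symm_apply_apply, swap_self]; exact mem_pinned_insert.2 ⟨hσ, h⟩)
  simp only [mem_union, mem_filter, mem_biUnion, mem_univ, true_and]
  obtain hz | hJ | hR | hpar := exists_conflict_of_mul_swap_notMem hF hzF hzR hσ hbad
  · exact .inl (.inl ⟨hσ, hz⟩)
  · exact .inl (.inr ⟨hσ, hσz, .inl hJ⟩)
  · exact .inl (.inr ⟨hσ, hσz, .inr hR⟩)
  · exact .inr ⟨hσ, hσz, hpar⟩

theorem card_filter_mul_swap_symm_notMem_le (hF : F ⊆ badEvents a b J)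
    (hb : LocalBounds a b J Δ h) (hM : 2 * (3 + #R + 2 * h + 2 * Δ ^ 2) ≤ Fintype.card α)
    (hzF : ∀ r ∈ insert z R, s(z, r) ∉ F) (hzR : ∀ r ∈ R, r.1 ≠ z.1 ∧ r.2 ≠ z.2) :
    (#{σ ∈ pinned F R | σ * swap z.1 (σ.symm z.2) ∉ pinned F (insert z R)} : ℝ) ≤
      (4 * h + 12 * Δ ^ 2) / Fintype.card α * #(pinned F R) := by
  let W : Finset (α × α) := J ∪ R.biUnion fun r => {w | Prod.map a b w = Prod.map a b r}
  have hW : (#W : ℝ) ≤ Fintype.card α * h + #R * Δ ^ 2 := by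
    exact_mod_cast (card_union_le _ _).trans (add_le_add hb.card_le
      (card_biUnion_le_card_mul _ _ _ fun r _ => hb.card_filter_map_eq_le _))
  have hover := card_filter_exists_over_le hF hb (R := R) (by omega) (Prod.map a b z)
  have hdisplaced := card_filter_displaced_mem_le hF hb (by omega) hzR W
  have hparallel := card_filter_displaced_parallel_le hF hb hM hzR
  have hR : (2 * #R : ℝ) ≤ Fintype.card α := by exact_mod_cast (by omega)
  have hM₀ : (0 : ℝ) < Fintype.card α := by exact_mod_cast (by omega : 0 < Fintype.card α)
  calc _ ≤ _ := Nat.cast_le.2 ((card_le_card (filter_mul_swap_symm_notMem_subset hF hzF hzR)).trans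
        ((card_union_le _ _).trans (Nat.add_le_add_right (card_union_le _ _) _)))
    _ ≤ ((Δ : ℝ) ^ 2 * (2 / Fintype.card α) + #W * (2 / Fintype.card α) ^ 2 +
          Fintype.card α ^ 2 * Δ ^ 2 * (2 / Fintype.card α) ^ 3) * #(pinned F R) := by
        push_cast
        linarith only [hover, hdisplaced, hparallel]
    _ ≤ _ := by
        gcongr
        calc _ ≤ (Δ : ℝ) ^ 2 * (2 / Fintype.card α) +
              (Fintype.card α * h + Fintype.card α / 2 * Δ ^ 2) * (2 / Fintype.card α) ^ 2 +
              Fintype.card α ^ 2 * Δ ^ 2 * (2 / Fintype.card α) ^ 3 := by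
              gcongr
              exact hW.trans (by gcongr; linarith)
          _ = _ := by field_simp; ring

theorem le_card_pinned_insert_mul (hF : F ⊆ badEvents a b J) (hb : LocalBounds a b J Δ h)
    (hM : 2 * (3 + #R + 2 * h + 2 * Δ ^ 2) ≤ Fintype.card α)
    (hzF : ∀ r ∈ insert z R, s(z, r) ∉ F) (hzR : ∀ r ∈ R, r.1 ≠ z.1 ∧ r.2 ≠ z.2) :
    (#(pinned F R) : ℝ) * (1 - (4 * h + 12 * Δ ^ 2) / Fintype.card α) ≤
      #(pinned F (insert z R)) * Fintype.card α := by
  have hbad := card_filter_mul_swap_symm_notMem_le hF hb hM hzF hzR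
  have hsplit : (#{σ ∈ pinned F R | σ * swap z.1 (σ.symm z.2) ∈ pinned F (insert z R)} +
      #{σ ∈ pinned F R | σ * swap z.1 (σ.symm z.2) ∉ pinned F (insert z R)} : ℝ) =
      #(pinned F R) := mod_cast card_filter_add_card_filter_not _
  calc _ ≤ (#{σ ∈ pinned F R | σ * swap z.1 (σ.symm z.2) ∈ pinned F (insert z R)} : ℝ) := by
        linarith
    _ = ∑ σ ∈ pinned F (insert z R), (#{p' | σ * swap z.1 p' ∈ pinned F R} : ℝ) := by
        rw [← sum_card_switch_eq fun _ hσ => (mem_pinned_insert.1 hσ).2, Nat.cast_sum]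
    _ ≤ ∑ _σ ∈ pinned F (insert z R), (Fintype.card α : ℝ) := by
        gcongr
        exact card_le_univ _
    _ = #(pinned F (insert z R)) * Fintype.card α := by simp

end Switching

section EventFrequency

variable {α V U : Type*} [DecidableEq α] [Fintype α] [Nonempty α] [DecidableEq V]
  [DecidableEq U] {a : α → V} {b : α → U} {J R : Finset (α × α)} {Δ h : ℕ} {ε : ℝ}
  {F : Finset (Sym2 (α × α))} {z : α × α}

theorem LocalBounds.one_le (hb : LocalBounds a b J Δ h) : 1 ≤ Δ := by
  obtain ⟨p⟩ := ‹Nonempty α›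
  exact (card_pos.2 ⟨p, by simp⟩).trans_le (hb.left (a p))

theorem LocalBounds.one_le_mul_card (hb : LocalBounds a b J Δ h)
    (hε : (h + Δ ^ 2 : ℝ) ≤ ε * Fintype.card α) : 1 ≤ ε * Fintype.card α := by
  have hΔ : (1 : ℝ) ≤ Δ ^ 2 := mod_cast Nat.one_le_pow _ _ hb.one_le
  linarith [Nat.cast_nonneg (α := ℝ) h]

theorem abs_card_pinned_insert_mul_sub_le (hF : F ⊆ badEvents a b J) (hb : LocalBounds a b J Δ h)
    (hε : (h + Δ ^ 2 : ℝ) ≤ ε * Fintype.card α) (hε₁ : 60 * ε ≤ 1) (hR : #R ≤ 1)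
    (hzF : ∀ r ∈ insert z R, s(z, r) ∉ F) (hzR : ∀ r ∈ R, r.1 ≠ z.1 ∧ r.2 ≠ z.2) :
    |#(pinned F (insert z R)) * Fintype.card α - (#(pinned F R) : ℝ)| ≤
      12 * ε * #(pinned F R) := by
  set P := (#(pinned F R) : ℝ)
  set Q := (#(pinned F (insert z R)) : ℝ)
  set M := (Fintype.card α : ℝ)
  have hP₀ : 0 ≤ P := Nat.cast_nonneg _
  have hQ₀ : 0 ≤ Q := Nat.cast_nonneg _
  have hM₀ : 0 < M := Nat.cast_pos.2 Fintype.card_pos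
  have hΔ : (1 : ℝ) ≤ Δ ^ 2 := mod_cast Nat.one_le_pow _ _ hb.one_le
  have hR' : (#R : ℝ) ≤ 1 := mod_cast hR
  have hεM : 60 * (ε * M) ≤ M := by nlinarith
  have hε₀ : 0 ≤ ε := by
    have := hb.one_le_mul_card hε
    exact le_of_mul_le_mul_right (by linarith) hM₀
  have hcard : 2 * (3 + #R + 2 * h + 2 * Δ ^ 2) ≤ Fintype.card α := by
    rify
    linarith [Nat.cast_nonneg (α := ℝ) h]
  have hupper : Q * (M - (#R + 2 * h + 2 * Δ ^ 2)) ≤ P :=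
    card_pinned_insert_mul_le hF hb fun hz => (hzR z hz).1 rfl
  have hlower : P * (1 - (4 * h + 12 * Δ ^ 2) / M) ≤ Q * M :=
    le_card_pinned_insert_mul hF hb hcard hzF hzR
  have hloss : (4 * h + 12 * Δ ^ 2) / M ≤ 12 * ε := by
    rw [div_le_iff₀ hM₀]
    linarith [Nat.cast_nonneg (α := ℝ) h]
  have hupper' : Q * M * (1 - 3 * ε) ≤ P := by
    nlinarith [Nat.cast_nonneg (α := ℝ) h]
  rw [abs_le]
  constructor
  · nlinarith
  · nlinarith [mul_nonneg hQ₀ hM₀.le, mul_nonneg hε₀ hP₀, mul_nonneg hε₀ hε₀]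

/-- The idealised frequency of an event: a permutation of `M` points takes each value prescribed
by the event with probability `1 / M`. -/
noncomputable def weight (e : Sym2 (α × α)) : ℝ := 1 / (Fintype.card α : ℝ) ^ #e.toFinset

theorem weight_pos (e : Sym2 (α × α)) : 0 < weight e := by
  have : 0 < Fintype.card α := Fintype.card_pos
  rw [weight]
  positivity

theorem weight_le (e : Sym2 (α × α)) : weight e ≤ 1 / Fintype.card α := by
  have hM : (1 : ℝ) ≤ Fintype.card α := Nat.one_le_cast.2 Fintype.card_pos
  have he : #e.toFinset ≠ 0 := by
    rw [Sym2.card_toFinset]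
    split_ifs <;> simp
  exact one_div_le_one_div_of_le (by linarith) (le_self_pow₀ hM he)

theorem abs_mul_sq_sub_le {P P' Q M : ℝ} (hε₀ : 0 ≤ ε) (hε₁ : 60 * ε ≤ 1) (hP : 0 ≤ P)
    (hM : 0 ≤ M) (hP' : |P' * M - P| ≤ 12 * ε * P) (hQ : |Q * M - P'| ≤ 12 * ε * P') :
    |Q * M ^ 2 - P| ≤ 30 * ε * P :=
  calc |Q * M ^ 2 - P| = |(Q * M - P') * M + (P' * M - P)| := by ring_nf
    _ ≤ |(Q * M - P') * M| + |P' * M - P| := abs_add_le _ _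
    _ ≤ 12 * ε * (P' * M) + 12 * ε * P := by
        rw [abs_mul, abs_of_nonneg hM, ← mul_assoc]
        gcongr
    _ ≤ 12 * ε * (P + 12 * ε * P) + 12 * ε * P := by
        gcongr
        linarith [(abs_le.1 hP').2]
    _ ≤ 30 * ε * P := by
        nlinarith [mul_nonneg hε₀ hP]

theorem abs_card_pinned_toFinset_mul_sub_le (hF : F ⊆ badEvents a b J)
    (hb : LocalBounds a b J Δ h) (hε : (h + Δ ^ 2 : ℝ) ≤ ε * Fintype.card α)
    (hε₁ : 60 * ε ≤ 1) {e : Sym2 (α × α)} (he : e ∈ badEvents a b J) (heF : e ∉ F) :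
    |#(pinned F e.toFinset) * (Fintype.card α : ℝ) ^ #e.toFinset - #(pinned F ∅)| ≤
      30 * ε * #(pinned F ∅) := by
  have hM₀ : (0 : ℝ) < Fintype.card α := Nat.cast_pos.2 Fintype.card_pos
  have hε₀ : 0 ≤ ε := le_of_mul_le_mul_right (by linarith [hb.one_le_mul_card hε]) hM₀
  have hsingle (z : α × α) (hz : s(z, z) ∉ F) :
      |#(pinned F {z}) * (Fintype.card α : ℝ) - #(pinned F ∅)| ≤ 12 * ε * #(pinned F ∅) :=
    abs_card_pinned_insert_mul_sub_le hF hb hε hε₁ (R := ∅) (by simp) (by simpa using hz)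
      (by simp)
  induction e using Sym2.ind with | _ x y => ?_
  rw [Sym2.toFinset_mk_eq]
  obtain ⟨rfl, -⟩ | ⟨hadj, hxJ, hyJ⟩ := mk_mem_badEvents.1 he
  · rw [pair_eq_singleton, card_singleton, pow_one]
    refine (hsingle x heF).trans ?_
    gcongr
    norm_num
  · have hx := diag_notMem_of_notMem hF hxJ
    rw [card_pair hadj.ne]
    refine abs_mul_sq_sub_le hε₀ hε₁ (Nat.cast_nonneg _) hM₀.le
      (hsingle y (diag_notMem_of_notMem hF hyJ)) ?_
    exact abs_card_pinned_insert_mul_sub_le hF hb hε hε₁ (by simp) (by simp [hx, heF])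
      (by simpa using ⟨hadj.1.symm, hadj.2.1.symm⟩)

theorem abs_card_pinned_toFinset_sub_le (hF : F ⊆ badEvents a b J)
    (hb : LocalBounds a b J Δ h) (hε : (h + Δ ^ 2 : ℝ) ≤ ε * Fintype.card α)
    (hε₁ : 60 * ε ≤ 1) {e : Sym2 (α × α)} (he : e ∈ badEvents a b J) (heF : e ∉ F) :
    |#(pinned F e.toFinset) - #(pinned F ∅) * weight e| ≤
      30 * ε * (#(pinned F ∅) * weight e) := by
  have hw := weight_pos e
  have hfactor : (#(pinned F e.toFinset) - #(pinned F ∅) * weight e : ℝ) =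
      (#(pinned F e.toFinset) * (Fintype.card α : ℝ) ^ #e.toFinset - #(pinned F ∅)) *
        weight e := by
    have : (Fintype.card α : ℝ) ≠ 0 := Nat.cast_ne_zero.2 Fintype.card_ne_zero
    rw [weight]
    field_simp
  rw [hfactor, abs_mul, abs_of_pos hw, ← mul_assoc]
  gcongr
  exact abs_card_pinned_toFinset_mul_sub_le hF hb hε hε₁ he heF

theorem expClose_card_pinned_badEvents (hb : LocalBounds a b J Δ h)
    (hε : (h + Δ ^ 2 : ℝ) ≤ ε * Fintype.card α) (hε₁ : 60 * ε ≤ 1) :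
    ExpClose (60 * ε * ∑ e ∈ badEvents a b J, weight e) #(pinned (badEvents a b J) ∅)
      ((Fintype.card α)! * Real.exp (-∑ e ∈ badEvents a b J, weight e)) := by
  have hM₀ : (0 : ℝ) < Fintype.card α := Nat.cast_pos.2 Fintype.card_pos
  have hsmall (e : Sym2 (α × α)) : 3 * weight e ≤ 30 * ε := by
    have : 1 / (Fintype.card α : ℝ) ≤ ε := (div_le_iff₀ hM₀).2 (hb.one_le_mul_card hε)
    linarith [weight_le e, weight_pos e]
  convert expClose_of_insert (fun F => (#(pinned F ∅) : ℝ)) weight (δ := 30 * ε) (by linarith)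
    (fun F => Nat.cast_nonneg _) (fun e _ => (weight_pos e).le) (fun e _ => hsmall e)
    (fun F e he hF => ?_) using 1
  · ring
  · simp [pinned, Fintype.card_perm]
  · obtain ⟨heBad, hF⟩ := insert_subset_iff.1 hF
    have hsplit : (#(pinned F ∅) - #(pinned (insert e F) ∅) : ℝ) = #(pinned F e.toFinset) :=
      sub_eq_of_eq_add' (mod_cast (card_pinned_insert_add F e).symm)
    rw [hsplit]
    exact abs_card_pinned_toFinset_sub_le hF hb hε hε₁ heBad he

end EventFrequency

section TotalWeight

variable {α V U : Type*} [Fintype α] [DecidableEq α]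

theorem card_filter_ne_fibre_eq [Fintype V] [DecidableEq V] (a : α → V) :
    #{x : α × α | x.1 ≠ x.2 ∧ a x.1 = a x.2} = ∑ v, (#{p | a p = v}).descFactorial 2 := by
  rw [card_eq_sum_card_fiberwise (f := fun x => a x.1) (t := univ) fun _ _ => mem_univ _]
  refine sum_congr rfl fun v _ => ?_
  rw [Nat.descFactorial_succ, Nat.descFactorial_one, tsub_mul, one_mul, ← offDiag_card]
  congr 1
  ext x
  simp only [mem_filter, mem_univ, true_and, mem_offDiag]
  grind

variable [DecidableEq V] [DecidableEq U] {a : α → V} {b : α → U} {J : Finset (α × α)} {Δ h : ℕ}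

theorem two_mul_card_edgeFinset_parallelGraph [Fintype V] [Fintype U] (a : α → V) (b : α → U) :
    2 * #(parallelGraph a b).edgeFinset =
      (∑ v, (#{p | a p = v}).descFactorial 2) * ∑ u, (#{q | b q = u}).descFactorial 2 := by
  rw [SimpleGraph.two_mul_card_edgeFinset, ← card_filter_ne_fibre_eq, ← card_filter_ne_fibre_eq,
    ← card_product]
  refine card_equiv (Equiv.prodProdProdComm α α α α) fun ⟨x, y⟩ => ?_
  simp only [mem_filter, mem_univ, true_and, mem_product, parallelGraph, Prod.ext_iff,
    Prod.map_fst, Prod.map_snd, Equiv.prodProdProdComm_apply]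
  tauto

theorem LocalBounds.degree_parallelGraph_le (hb : LocalBounds a b J Δ h) (x : α × α) :
    (parallelGraph a b).degree x ≤ Δ ^ 2 := by
  rw [← SimpleGraph.card_neighborFinset_eq_degree]
  refine (card_le_card fun y hy => ?_).trans (hb.card_filter_map_eq_le (Prod.map a b x))
  exact mem_filter.2 ⟨mem_univ _, ((SimpleGraph.mem_neighborFinset _ _ _).1 hy).2.2.symm⟩

theorem LocalBounds.two_mul_card_edgeFinset_le (hb : LocalBounds a b J Δ h) :
    2 * #(parallelGraph a b).edgeFinset ≤ Fintype.card α ^ 2 * Δ ^ 2 := by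
  rw [← SimpleGraph.sum_degrees_eq_twice_card_edges, sq (Fintype.card α), ← Fintype.card_prod,
    ← card_univ, ← smul_eq_mul]
  exact sum_le_card_nsmul _ _ _ fun x _ => hb.degree_parallelGraph_le x

theorem LocalBounds.card_edgeFinset_meeting_le (hb : LocalBounds a b J Δ h) :
    #{e ∈ (parallelGraph a b).edgeFinset | ¬∀ x ∈ e, x ∉ J} ≤ Fintype.card α * h * Δ ^ 2 := by
  have hsub : {e ∈ (parallelGraph a b).edgeFinset | ¬∀ x ∈ e, x ∉ J} ⊆
      J.biUnion fun x => (parallelGraph a b).incidenceFinset x := by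
    intro e he
    simp only [mem_filter, not_forall, not_not] at he
    obtain ⟨heE, x, hxe, hxJ⟩ := he
    exact mem_biUnion.2 ⟨x, hxJ, by
      simpa [SimpleGraph.incidenceSet] using ⟨SimpleGraph.mem_edgeFinset.1 heE, hxe⟩⟩
  calc _ ≤ #J * Δ ^ 2 := (card_le_card hsub).trans (card_biUnion_le_card_mul _ _ _ fun x _ => by
        simpa using hb.degree_parallelGraph_le x)
    _ ≤ Fintype.card α * h * Δ ^ 2 := Nat.mul_le_mul_right _ hb.card_le

theorem sum_weight_badEvents (a : α → V) (b : α → U) (J : Finset (α × α)) :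
    ∑ e ∈ badEvents a b J, weight e = (#J : ℝ) / Fintype.card α +
      (#{e ∈ (parallelGraph a b).edgeFinset | ∀ x ∈ e, x ∉ J} : ℝ) / Fintype.card α ^ 2 := by
  have hdisj : Disjoint (J.image Sym2.diag)
      {e ∈ (parallelGraph a b).edgeFinset | ∀ x ∈ e, x ∉ J} := by
    simp only [disjoint_left, mem_image, mem_filter, SimpleGraph.mem_edgeFinset]
    rintro _ ⟨x, -, rfl⟩ ⟨hx, -⟩
    exact SimpleGraph.not_isDiag_of_mem_edgeSet _ hx (Sym2.diag_isDiag x)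
  have hdiag (x : α × α) : weight (Sym2.diag x) = 1 / Fintype.card α := by
    rw [weight, Sym2.card_toFinset_of_isDiag _ (Sym2.diag_isDiag x), pow_one]
  have hedge : ∀ e ∈ (parallelGraph a b).edgeFinset,
      weight e = 1 / (Fintype.card α : ℝ) ^ 2 := fun e he => by
    rw [weight, Sym2.card_toFinset_of_not_isDiag _
      (SimpleGraph.not_isDiag_of_mem_edgeSet _ (SimpleGraph.mem_edgeFinset.1 he))]
  rw [badEvents, sum_union hdisj, sum_image Sym2.diag_injective.injOn,
    sum_congr rfl fun x _ => hdiag x,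
    sum_congr rfl fun e he => hedge e (mem_filter.1 he).1, sum_const, sum_const,
    nsmul_eq_mul, nsmul_eq_mul, mul_one_div, mul_one_div]

theorem LocalBounds.sum_weight_le [Nonempty α] (hb : LocalBounds a b J Δ h) :
    ∑ e ∈ badEvents a b J, weight e ≤ h + Δ ^ 2 := by
  have hM₀ : (0 : ℝ) < Fintype.card α := Nat.cast_pos.2 Fintype.card_pos
  have hJ : (#J : ℝ) ≤ h * Fintype.card α := by
    rw [mul_comm]
    exact_mod_cast hb.card_le
  have hE : (#{e ∈ (parallelGraph a b).edgeFinset | ∀ x ∈ e, x ∉ J} : ℝ) ≤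
      Δ ^ 2 * Fintype.card α ^ 2 := by
    have hedges := hb.two_mul_card_edgeFinset_le
    have hsub := card_filter_le (parallelGraph a b).edgeFinset fun e => ∀ x ∈ e, x ∉ J
    rw [mul_comm]
    exact_mod_cast (by omega)
  rw [sum_weight_badEvents]
  exact add_le_add ((div_le_iff₀ hM₀).2 hJ) ((div_le_iff₀ (by positivity)).2 hE)

/-- The expected number of forbidden pairs and of parallel pairs of edges in the projection of a
random permutation, up to lower order terms. -/
noncomputable def expectedConflicts [Fintype V] [Fintype U] (a : α → V) (b : α → U)
    (J : Finset (α × α)) : ℝ :=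
  (#J : ℝ) / Fintype.card α +
    (∑ v, ((#{p | a p = v}).descFactorial 2 : ℝ)) * (∑ u, ((#{q | b q = u}).descFactorial 2 : ℝ)) /
      (2 * (Fintype.card α : ℝ) ^ 2)

theorem expectedConflicts_eq [Fintype V] [Fintype U] (a : α → V) (b : α → U)
    (J : Finset (α × α)) :
    expectedConflicts a b J = (#J : ℝ) / Fintype.card α +
      (#(parallelGraph a b).edgeFinset : ℝ) / (Fintype.card α : ℝ) ^ 2 := by
  have hcount : 2 * (#(parallelGraph a b).edgeFinset : ℝ) =
      (∑ v, ((#{p | a p = v}).descFactorial 2 : ℝ)) *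
        ∑ u, ((#{q | b q = u}).descFactorial 2 : ℝ) :=
    mod_cast two_mul_card_edgeFinset_parallelGraph a b
  rw [expectedConflicts, ← hcount, mul_div_mul_left _ _ two_ne_zero]

theorem LocalBounds.abs_sum_weight_sub_le [Nonempty α] [Fintype V] [Fintype U]
    (hb : LocalBounds a b J Δ h) :
    |∑ e ∈ badEvents a b J, weight e - expectedConflicts a b J| ≤
      (h * Δ ^ 2 : ℝ) / Fintype.card α := by
  have hM₀ : (0 : ℝ) < Fintype.card α := Nat.cast_pos.2 Fintype.card_pos
  have hsplit : (#{e ∈ (parallelGraph a b).edgeFinset | ∀ x ∈ e, x ∉ J} +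
      #{e ∈ (parallelGraph a b).edgeFinset | ¬∀ x ∈ e, x ∉ J} : ℝ) =
      #(parallelGraph a b).edgeFinset := mod_cast card_filter_add_card_filter_not _
  have hmeet : (#{e ∈ (parallelGraph a b).edgeFinset | ¬∀ x ∈ e, x ∉ J} : ℝ) ≤
      Fintype.card α * h * Δ ^ 2 := mod_cast hb.card_edgeFinset_meeting_le
  rw [sum_weight_badEvents, expectedConflicts_eq, add_sub_add_left_eq_sub, ← sub_div,
    ← hsplit, sub_add_cancel_left, neg_div, abs_neg, abs_of_nonneg (by positivity),
    div_le_div_iff₀ (by positivity) hM₀]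
  calc _ ≤ Fintype.card α * h * Δ ^ 2 * (Fintype.card α : ℝ) := by gcongr
    _ = _ := by ring

theorem expClose_card_pinned [Fintype V] [Fintype U] (hb : LocalBounds a b J Δ h)
    (hM₀ : 0 < Fintype.card α) (hM : 60 * (h + Δ ^ 2) ≤ Fintype.card α) :
    ExpClose (61 * (h + Δ ^ 2) ^ 2 / Fintype.card α) #(pinned (badEvents a b J) ∅)
      ((Fintype.card α)! * Real.exp (-expectedConflicts a b J)) := by
  have : Nonempty α := Fintype.card_pos_iff.1 hM₀
  have hM₀ : (0 : ℝ) < Fintype.card α := Nat.cast_pos.2 hM₀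
  have hM : 60 * (h + Δ ^ 2 : ℝ) ≤ Fintype.card α := mod_cast hM
  set ε : ℝ := (h + Δ ^ 2) / Fintype.card α with hε
  have hsieve := expClose_card_pinned_badEvents hb (ε := ε) (div_mul_cancel₀ _ hM₀.ne').ge
    (by rwa [hε, ← mul_div_assoc, div_le_one hM₀])
  have hexp : ExpClose ((h * Δ ^ 2 : ℝ) / Fintype.card α)
      (Real.exp (-∑ e ∈ badEvents a b J, weight e)) (Real.exp (-expectedConflicts a b J)) :=
    expClose_exp (by rw [neg_sub_neg, abs_sub_comm]; exact hb.abs_sum_weight_sub_le)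
  refine (hsieve.trans (hexp.const_mul (Nat.cast_nonneg _))).mono (by positivity) ?_
  have hpair : (h * Δ ^ 2 : ℝ) ≤ (h + Δ ^ 2) ^ 2 := by
    have : (0 : ℝ) ≤ h * Δ ^ 2 := by positivity
    linarith [add_sq (h : ℝ) (Δ ^ 2), sq_nonneg (h : ℝ), sq_nonneg (Δ ^ 2 : ℝ)]
  calc 60 * ε * ∑ e ∈ badEvents a b J, weight e + (h * Δ ^ 2 : ℝ) / Fintype.card α
      ≤ 60 * ε * (h + Δ ^ 2) + (h + Δ ^ 2 : ℝ) ^ 2 / Fintype.card α := by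
        gcongr
        exact hb.sum_weight_le
    _ = 61 * (h + Δ ^ 2 : ℝ) ^ 2 / Fintype.card α := by rw [hε]; ring

end TotalWeight

section Projection

variable {α β V U : Type*} {a : α → V} {b : α → U} {G H : Finset (V × U)} {Δ d : ℕ}

theorem mk_trans_symm_eq {e₁ e₂ : α ≃ G} (h₁ : ∀ p, (e₁ p).1.1 = a p)
    (h₂ : ∀ q, (e₂ q).1.2 = b q) (p : α) : (a p, b (e₁.trans e₂.symm p)) = (e₁ p).1 := by
  rw [← h₁, ← h₂, Equiv.trans_apply, Equiv.apply_symm_apply]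

variable [Fintype α] [DecidableEq V]

theorem exists_map_card_fibre_eq [Fintype V] {s : V → ℕ}
    (hs : Fintype.card α = ∑ v, s v) : ∃ a : α → V, ∀ v, #{p | a p = v} = s v := by
  let e : α ≃ Σ v, Fin (s v) := Fintype.equivOfCardEq (by simp [hs])
  refine ⟨fun p => (e p).1, fun v => ?_⟩
  rw [← Fintype.card_subtype, ← Fintype.card_fin (s v)]
  exact Fintype.card_congr ((e.subtypeEquiv fun _ => Iff.rfl).trans (Equiv.sigmaSubtype v))

theorem card_equiv_over [DecidableEq α] [Fintype β] [DecidableEq β] [Fintype V] (f : α → V)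
    (g : β → V) (hfg : ∀ v, #{p | f p = v} = #{x | g x = v}) :
    Fintype.card {e : α ≃ β // ∀ p, g (e p) = f p} = ∏ v, (#{p | f p = v})! := by
  have hfibre (v : V) : Nonempty ({p // f p = v} ≃ {x // g x = v}) :=
    Fintype.card_eq.1 (by rw [Fintype.card_subtype, Fintype.card_subtype, hfg])
  let e₀ : α ≃ β := Equiv.ofFiberEquiv fun v => (hfibre v).some
  have he₀ (p : α) : g (e₀ p) = f p := Equiv.ofFiberEquiv_map _ p
  have hperm : {e : α ≃ β // ∀ p, g (e p) = f p} ≃ {σ : Perm α // f ∘ σ = f} :=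
    ((Equiv.refl α).equivCongr e₀.symm).subtypeEquiv fun e => by
      simp [funext_iff, ← he₀]
  rw [Fintype.card_congr hperm, DomMulAct.stabilizer_card]
  simp only [Fintype.card_subtype]

variable [DecidableEq U]

/-- The bipartite graph obtained from a permutation, seen as a perfect matching between two copies
of `α`, by contracting the fibres of `a` and of `b`. -/
def project (a : α → V) (b : α → U) (σ : Perm α) : Finset (V × U) :=
  univ.image fun p => (a p, b (σ p))

theorem exists_equiv_iff_project_eq {σ : Perm α} :
    (∃ e : α ≃ G, ∀ p, (e p).1 = (a p, b (σ p))) ↔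
      Function.Injective (fun p => (a p, b (σ p))) ∧ project a b σ = G := by
  constructor
  · rintro ⟨e, he⟩
    simp only [project, ← he]
    refine ⟨Subtype.val_injective.comp e.injective, ?_⟩
    ext x
    simp only [mem_image, mem_univ, true_and]
    exact ⟨by rintro ⟨p, rfl⟩; exact (e p).2, fun hx => ⟨e.symm ⟨x, hx⟩, by simp⟩⟩
  · rintro ⟨hinj, rfl⟩
    refine ⟨Equiv.ofBijective (fun p => ⟨(a p, b (σ p)), mem_image_of_mem _ (mem_univ p)⟩)
      ⟨fun p q hpq => hinj (congrArg Subtype.val hpq), fun x => ?_⟩, fun p => rfl⟩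
    obtain ⟨p, -, hp⟩ := mem_image.1 x.2
    exact ⟨p, Subtype.ext hp⟩

theorem card_filter_map_mem (a : α → V) (b : α → U) (H : Finset (V × U)) :
    #{x : α × α | Prod.map a b x ∈ H} = ∑ e ∈ H, #{p | a p = e.1} * #{q | b q = e.2} := by
  rw [card_eq_sum_card_fiberwise (f := Prod.map a b) (t := H) fun x hx => by
    simpa using hx]
  refine sum_congr rfl fun e he => ?_
  rw [← card_product]
  congr 1
  ext x
  simp only [mem_filter, mem_univ, true_and, mem_product, Prod.ext_iff, Prod.map_fst, Prod.map_snd]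
  refine and_iff_right_of_imp fun h => ?_
  rwa [Prod.map_apply', h.1, h.2]

variable [DecidableEq α]

theorem mem_pinned_badEvents {J : Finset (α × α)} {σ : Perm α} : σ ∈ pinned (badEvents a b J) ∅ ↔
    Function.Injective (fun p => (a p, b (σ p))) ∧ ∀ p, (p, σ p) ∉ J := by
  simp only [mem_pinned, notMem_empty, false_imp_iff, implies_true, true_and, mk_mem_badEvents]
  constructor
  · intro h
    have hJ (p : α) : (p, σ p) ∉ J := fun hp => h _ _ (.inl ⟨rfl, hp⟩) rfl rfl
    refine ⟨fun p q hpq => by_contra fun hne => ?_, hJ⟩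
    exact h (p, σ p) (q, σ q) (.inr ⟨⟨hne, σ.injective.ne hne, hpq⟩, hJ p, hJ q⟩) rfl rfl
  · rintro ⟨hinj, hJ⟩ ⟨p, p'⟩ ⟨q, q'⟩ h hp hq
    obtain rfl : σ p = p' := hp
    obtain rfl : σ q = q' := hq
    obtain ⟨-, hJp⟩ | ⟨⟨hne, -, hpq⟩, -⟩ := h
    · exact hJ p hJp
    · exact hne (hinj hpq)

theorem localBounds_preimage (ha : ∀ v, #{p | a p = v} ≤ Δ) (hb : ∀ u, #{q | b q = u} ≤ Δ)
    (hl : ∀ v, #{e ∈ H | e.1 = v} ≤ d) (hr : ∀ u, #{e ∈ H | e.2 = u} ≤ d) :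
    LocalBounds a b {x | Prod.map a b x ∈ H} Δ (d * Δ) where
  left := ha
  right := hb
  row p := calc
    _ ≤ #({e ∈ H | e.1 = a p}.biUnion fun e => {q | b q = e.2}) :=
      card_le_card fun q hq => by simpa using hq
    _ ≤ #{e ∈ H | e.1 = a p} * Δ := card_biUnion_le_card_mul _ _ _ fun e _ => hb e.2
    _ ≤ d * Δ := Nat.mul_le_mul_right _ (hl _)
  col q := calc
    _ ≤ #({e ∈ H | e.2 = b q}.biUnion fun e => {p | a p = e.1}) :=
      card_le_card fun p hp => by simpa using hp
    _ ≤ #{e ∈ H | e.2 = b q} * Δ := card_biUnion_le_card_mul _ _ _ fun e _ => ha e.1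
    _ ≤ d * Δ := Nat.mul_le_mul_right _ (hr _)

variable [Fintype V] [Fintype U]

theorem card_filter_project_eq (hl : ∀ v, #{e ∈ G | e.1 = v} = #{p | a p = v})
    (hr : ∀ u, #{e ∈ G | e.2 = u} = #{q | b q = u}) :
    #{σ : Perm α | Function.Injective (fun p => (a p, b (σ p))) ∧ project a b σ = G} =
      (∏ v, (#{p | a p = v})!) * ∏ u, (#{q | b q = u})! := by
  have hcoe (P : V × U → Prop) [DecidablePred P] : #{x : G | P x.1} = #{e ∈ G | P e} := by
    simpa only [card_filter] using sum_coe_sort G fun e => if P e then 1 else 0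
  rw [← card_equiv_over a (fun x : G => x.1.1) fun v => by rw [hcoe fun e => e.1 = v, hl],
    ← card_equiv_over b (fun x : G => x.1.2) fun u => by rw [hcoe fun e => e.2 = u, hr],
    ← Fintype.card_prod, ← Fintype.card_subtype]
  refine (Fintype.card_of_bijective (f := fun e => ⟨e.1.1.trans e.2.1.symm,
    exists_equiv_iff_project_eq.1 ⟨e.1.1, fun p => (mk_trans_symm_eq e.1.2 e.2.2 p).symm⟩⟩)
    ⟨?_, ?_⟩).symm
  · rintro ⟨⟨e₁, h₁⟩, ⟨e₂, h₂⟩⟩ ⟨⟨f₁, k₁⟩, ⟨f₂, k₂⟩⟩ h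
    have hσ : e₁.trans e₂.symm = f₁.trans f₂.symm := congrArg Subtype.val h
    obtain rfl : e₁ = f₁ := Equiv.ext fun p => Subtype.ext <| by
      rw [← mk_trans_symm_eq h₁ h₂, ← mk_trans_symm_eq k₁ k₂, hσ]
    obtain rfl : e₂ = f₂ := Equiv.symm_bijective.injective <| Equiv.ext fun x => by
      simpa using DFunLike.congr_fun hσ (e₁.symm x)
    rfl
  · rintro ⟨σ, hσ⟩
    obtain ⟨e, he⟩ := exists_equiv_iff_project_eq.2 hσ
    refine ⟨⟨⟨e, fun p => by rw [he]⟩, ⟨σ.symm.trans e, fun q => by simp [he]⟩⟩, ?_⟩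
    exact Subtype.ext (Equiv.ext fun p => by simp)

theorem card_filter_disjoint_project_eq (a : α → V) (b : α → U) (H : Finset (V × U)) :
    #{σ : Perm α | Function.Injective (fun p => (a p, b (σ p))) ∧ Disjoint (project a b σ) H} =
      #{G : Finset (V × U) | ((∀ v, #{e ∈ G | e.1 = v} = #{p | a p = v}) ∧
        ∀ u, #{e ∈ G | e.2 = u} = #{q | b q = u}) ∧ Disjoint G H} *
      ((∏ v, (#{p | a p = v})!) * ∏ u, (#{q | b q = u})!) := by
  rw [card_eq_sum_card_fiberwise (f := project a b) (t := {G : Finset (V × U) |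
    ((∀ v, #{e ∈ G | e.1 = v} = #{p | a p = v}) ∧
      ∀ u, #{e ∈ G | e.2 = u} = #{q | b q = u}) ∧ Disjoint G H}), ← smul_eq_mul, ← sum_const]
  · refine sum_congr rfl fun G hG => ?_
    obtain ⟨⟨hl, hr⟩, hGH⟩ := (mem_filter.1 hG).2
    rw [← card_filter_project_eq hl hr, filter_filter]
    congr 1
    ext σ
    simp only [mem_filter, mem_univ, true_and]
    exact ⟨fun h => ⟨h.1.1, h.2⟩, fun h => ⟨⟨h.1, h.2.symm ▸ hGH⟩, h.2⟩⟩
  · intro σ hσ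
    obtain ⟨hinj, hH⟩ := (mem_filter.1 hσ).2
    refine mem_filter.2 ⟨mem_univ _, ⟨fun v => ?_, fun u => ?_⟩, hH⟩
    · rw [project, filter_image, card_image_of_injective _ hinj]
    · rw [project, filter_image, card_image_of_injective _ hinj]
      exact card_equiv σ fun p => by simp

end Projection

section Covariance

variable {ι : Type*} {E : Finset ι} {g : ι → ℝ} {B : ℝ}

theorem abs_sum_mul_sub_le (f : ι → ℝ) (hg₀ : ∀ i ∈ E, 0 ≤ g i) (hgB : ∀ i ∈ E, g i ≤ B) (c : ℝ) :
    |∑ i ∈ E, f i * g i - (∑ i ∈ E, f i) * (∑ i ∈ E, g i) / #E| ≤ B * ∑ i ∈ E, |f i - c| := by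
  obtain rfl | hE := E.eq_empty_or_nonempty
  · simp
  have hcard : (0 : ℝ) < #E := Nat.cast_pos.2 hE.card_pos
  set m := (∑ i ∈ E, g i) / #E with hm
  have hm₀ : 0 ≤ m := div_nonneg (sum_nonneg hg₀) hcard.le
  have hmB : m ≤ B := (div_le_iff₀' hcard).2 (nsmul_eq_mul #E B ▸ sum_le_card_nsmul E g B hgB)
  have hcentred : ∑ i ∈ E, (g i - m) = 0 := by
    rw [sum_sub_distrib, sum_const, nsmul_eq_mul, hm, mul_div_cancel₀ _ hcard.ne', sub_self]
  have hcov : ∑ i ∈ E, f i * g i - (∑ i ∈ E, f i) * (∑ i ∈ E, g i) / #E =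
      ∑ i ∈ E, (f i - c) * (g i - m) := by
    calc _ = ∑ i ∈ E, f i * g i - (∑ i ∈ E, f i) * m - c * ∑ i ∈ E, (g i - m) := by
          rw [hcentred, mul_zero, sub_zero, mul_div_assoc]
      _ = _ := by
          simp only [sum_mul, mul_sum, ← sum_sub_distrib]
          exact sum_congr rfl fun i _ => by ring
  rw [hcov, mul_sum]
  refine (abs_sum_le_sum_abs _ _).trans (sum_le_sum fun i hi => ?_)
  rw [abs_mul, mul_comm]
  gcongr
  exact abs_le.2 ⟨by linarith [hg₀ i hi], by linarith [hgB i hi]⟩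

theorem le_maxEntry {k : ℕ} (s : Fin k → ℕ) (v : Fin k) : s v ≤ maxEntry s :=
  le_sup (f := s) (mem_univ v)

theorem sum_comp_eq_of_card_fibre_eq {k : ℕ} {π : ι → Fin k} {x : Fin k → ℕ}
    (hx : ∀ v, #{i ∈ E | π i = v} = x v) (f : Fin k → ℝ) :
    ∑ i ∈ E, f (π i) = ∑ v, f v * x v := by
  simp only [← sum_fiberwise' E π f, sum_const, hx, nsmul_eq_mul, mul_comm]

theorem abs_sum_mul_sub_le_irregularity {k : ℕ} {π : ι → Fin k} {x : Fin k → ℕ}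
    (hx : ∀ v, #{i ∈ E | π i = v} = x v) (s : Fin k → ℕ) (hg₀ : ∀ i ∈ E, 0 ≤ g i)
    (hgB : ∀ i ∈ E, g i ≤ B) (hB : 0 ≤ B) :
    |∑ i ∈ E, (s (π i) : ℝ) * g i - (∑ v, (s v : ℝ) * x v) * (∑ i ∈ E, g i) / #E| ≤
      irregularity s * B * maxEntry x := by
  rw [← sum_comp_eq_of_card_fibre_eq hx fun v => (s v : ℝ)]
  calc _ ≤ B * ∑ i ∈ E, |(s (π i) : ℝ) - average s| := abs_sum_mul_sub_le _ hg₀ hgB _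
    _ = B * ∑ v, |(s v : ℝ) - average s| * x v := by
        rw [sum_comp_eq_of_card_fibre_eq hx fun v => |(s v : ℝ) - average s|]
    _ ≤ B * ∑ v, |(s v : ℝ) - average s| * maxEntry x := by
        gcongr
        exact le_maxEntry x _
    _ = irregularity s * B * maxEntry x := by
        rw [← sum_mul, irregularity]
        ring

variable {n m : ℕ} {H : BipGraph n m} {x : Fin n → ℕ} {y : Fin m → ℕ}

theorem min_xiS_xiT_nonneg (s x : Fin n → ℕ) (t y : Fin m → ℕ) :
    0 ≤ min (xiS s t x) (xiT s t y) := by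
  refine le_min ?_ ?_ <;> simp only [xiS, xiT, irregularity] <;> positivity

theorem HasDegrees.card_eq (hH : HasDegrees H x y) : #H = total x := by
  rw [total, card_eq_sum_card_fiberwise (f := Prod.fst) fun _ _ => mem_univ _]
  exact sum_congr rfl fun v _ => hH.1 v

theorem HasDegrees.abs_sum_edges_sub_le (hH : HasDegrees H x y) (s : Fin n → ℕ)
    (t : Fin m → ℕ) :
    |(∑ e ∈ H, (s e.1 : ℝ) * t e.2) / total s -
      (∑ v, (s v : ℝ) * x v) * (∑ u, (t u : ℝ) * y u) / (total s * total x)| ≤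
      min (xiS s t x) (xiT s t y) := by
  have hleft := abs_sum_mul_sub_le_irregularity hH.1 s (g := fun e => (t e.2 : ℝ))
    (fun _ _ => Nat.cast_nonneg _) (fun e _ => Nat.cast_le.2 (le_maxEntry t e.2))
    (Nat.cast_nonneg _)
  have hright := abs_sum_mul_sub_le_irregularity hH.2 t (g := fun e => (s e.1 : ℝ))
    (fun _ _ => Nat.cast_nonneg _) (fun e _ => Nat.cast_le.2 (le_maxEntry s e.1))
    (Nat.cast_nonneg _)
  rw [sum_comp_eq_of_card_fibre_eq hH.2 fun u => (t u : ℝ), hH.card_eq] at hleft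
  rw [sum_comp_eq_of_card_fibre_eq hH.1 fun v => (s v : ℝ), hH.card_eq] at hright
  simp only [mul_comm (t _ : ℝ) (s _ : ℝ)] at hright
  rw [mul_comm (total s : ℝ), ← div_div, ← sub_div, abs_div, Nat.abs_cast, le_min_iff, xiS, xiT]
  constructor
  · gcongr
  · rw [mul_comm (∑ v, (s v : ℝ) * x v)]
    gcongr

end Covariance

section Enumeration

variable {n m : ℕ} {s x : Fin n → ℕ} {t y : Fin m → ℕ} {H : BipGraph n m} {Δ d : ℕ}

/-- The bipartite graphs with degrees `(s, t)` that are edge-disjoint from `H`. -/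
def disjointFrom (s : Fin n → ℕ) (t : Fin m → ℕ) (H : BipGraph n m) : Finset (BipGraph n m) :=
  {G | HasDegrees G s t ∧ Disjoint G H}

/-- The estimate for the number of bipartite graphs with degrees `(s, t)` that are edge-disjoint
from a given graph, where `μ` is the expected number of edges in common with it. The first factor
is the number of perfect matchings per simple graph in the pairing model. -/
noncomputable def disjointEstimate (s : Fin n → ℕ) (t : Fin m → ℕ) (μ : ℝ) : ℝ :=
  (total s)! / ((∏ v, ((s v)! : ℝ)) * ∏ u, ((t u)! : ℝ)) *
    Real.exp (-(μ + (fallTwo s : ℝ) * fallTwo t / (2 * (total s : ℝ) ^ 2)))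

theorem disjointEstimate_pos (s : Fin n → ℕ) (t : Fin m → ℕ) (μ : ℝ) :
    0 < disjointEstimate s t μ := by
  unfold disjointEstimate
  positivity

theorem expClose_disjointEstimate {μ ν ρ : ℝ} (h : |μ - ν| ≤ ρ) :
    ExpClose ρ (disjointEstimate s t μ) (disjointEstimate s t ν) :=
  (expClose_exp (by rwa [neg_sub_neg, add_sub_add_right_eq_sub, abs_sub_comm])).const_mul
    (by positivity)

theorem expClose_card_disjointFrom (hst : total s = total t) (hM₀ : 0 < total s)
    (hs : ∀ v, s v ≤ Δ) (ht : ∀ u, t u ≤ Δ) (hl : ∀ v, degLeft H v ≤ d)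
    (hr : ∀ u, degRight H u ≤ d) (hM : 60 * (d * Δ + Δ ^ 2) ≤ total s) :
    ExpClose (61 * (d * Δ + Δ ^ 2) ^ 2 / total s) #(disjointFrom s t H)
      (disjointEstimate s t ((∑ e ∈ H, (s e.1 : ℝ) * t e.2) / total s)) := by
  obtain ⟨a, ha⟩ := exists_map_card_fibre_eq (α := Fin (total s)) (s := s) (Fintype.card_fin _)
  obtain ⟨b, hb⟩ := exists_map_card_fibre_eq (α := Fin (total s)) (s := t)
    ((Fintype.card_fin _).trans hst)
  set J : Finset (Fin (total s) × Fin (total s)) := {x | Prod.map a b x ∈ H} with hJ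
  have hcount : #(pinned (badEvents a b J) ∅) =
      #(disjointFrom s t H) * ((∏ v, (s v)!) * ∏ u, (t u)!) := by
    have hproj := card_filter_disjoint_project_eq a b H
    simp only [ha, hb] at hproj
    rw [disjointFrom]
    refine .trans (congrArg card (ext fun σ => ?_)) hproj
    simp [mem_pinned_badEvents, project, disjoint_left, hJ]
  have hconflicts : expectedConflicts a b J = (∑ e ∈ H, (s e.1 : ℝ) * t e.2) / total s +
      (fallTwo s : ℝ) * fallTwo t / (2 * (total s : ℝ) ^ 2) := by
    simp only [expectedConflicts, hJ, card_filter_map_mem, ha, hb, Fintype.card_fin, fallTwo,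
      Nat.cast_sum, Nat.cast_mul]
  have hclose := expClose_card_pinned
    (localBounds_preimage (fun v => (ha v).trans_le (hs v)) (fun u => (hb u).trans_le (ht u)) hl hr)
    (by simpa using hM₀) (by simpa using hM)
  rw [← hJ, hcount, hconflicts, Fintype.card_fin] at hclose
  convert hclose.mul_const (C := ((∏ v, ((s v)! : ℝ)) * ∏ u, ((t u)! : ℝ))⁻¹) (by positivity)
    using 1
  · push_cast; rfl
  · push_cast
    rw [mul_inv_cancel_right₀ (by positivity)]
  · rw [disjointEstimate]
    ring

theorem BP_eq_sum (s x : Fin n → ℕ) (t y : Fin m → ℕ) :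
    BP s t x y = ∑ H ∈ disjointFrom x y ∅, #(disjointFrom s t H) := by
  rw [← card_sigma]
  refine card_bij (fun p _ => ⟨p.2, p.1⟩) ?_ ?_ ?_
  · rintro ⟨G, H⟩ h
    simp_all [disjointFrom]
  · rintro ⟨G, H⟩ - ⟨G', H'⟩ - h
    simp_all
  · rintro ⟨H, G⟩ h
    exact ⟨(G, H), by simp_all [disjointFrom], rfl⟩

theorem FHat_eq (s x : Fin n → ℕ) (t y : Fin m → ℕ) :
    FHat s t x y = disjointEstimate x y 0 * disjointEstimate s t
      ((∑ v, (s v : ℝ) * x v) * (∑ u, (t u : ℝ) * y u) / (total s * total x)) := by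
  rw [disjointEstimate, disjointEstimate, mul_mul_mul_comm, ← Real.exp_add, div_mul_div_comm, FHat,
    prod_mul_distrib, prod_mul_distrib]
  congr 2 <;> ring

theorem FHat_pos (s x : Fin n → ℕ) (t y : Fin m → ℕ) : 0 < FHat s t x y := by
  rw [FHat]
  positivity

theorem sixty_mul_le_of_div_lt {A B M : ℕ} (hM₀ : 0 < M)
    (hAB : ((A : ℝ) ^ 4 + A ^ 2 * B ^ 2) / M < 1 / 60) : 60 * (B * A + A ^ 2) ≤ M := by
  rw [div_lt_iff₀ (Nat.cast_pos.2 hM₀)] at hAB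
  have hAB : 60 * (A ^ 4 + A ^ 2 * B ^ 2) < M := by
    exact_mod_cast (by linarith : (60 * (A ^ 4 + A ^ 2 * B ^ 2) : ℝ) < M)
  have hA : A ^ 2 ≤ A ^ 4 := by
    rw [show A ^ 4 = (A ^ 2) ^ 2 by ring]
    exact Nat.le_self_pow two_ne_zero _
  have hBA : B * A ≤ A ^ 2 * B ^ 2 := by
    rw [← mul_pow, mul_comm B]
    exact Nat.le_self_pow two_ne_zero _
  omega

theorem xi_eq (s x : Fin n → ℕ) (t y : Fin m → ℕ) :
    xi s t x y =
      (((maxEntry s + maxEntry t : ℕ) : ℝ) ^ 4 + ((maxEntry s + maxEntry t : ℕ) : ℝ) ^ 2 *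
        ((maxEntry x + maxEntry y : ℕ) : ℝ) ^ 2) / total s +
      ((maxEntry x + maxEntry y : ℕ) : ℝ) ^ 4 / total x := by
  rw [xi, add_div]
  push_cast
  rfl

theorem HasDegrees.expClose_card_disjointFrom (hH : HasDegrees H x y) (hst : total s = total t)
    (hM₀ : 0 < total s) (hs : ∀ v, s v ≤ Δ) (ht : ∀ u, t u ≤ Δ) (hx : ∀ v, x v ≤ d)
    (hy : ∀ u, y u ≤ d) (hM : 60 * (d * Δ + Δ ^ 2) ≤ total s) :
    ExpClose (61 * (d * Δ + Δ ^ 2) ^ 2 / total s + min (xiS s t x) (xiT s t y))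
      #(disjointFrom s t H) (disjointEstimate s t
        ((∑ v, (s v : ℝ) * x v) * (∑ u, (t u : ℝ) * y u) / (total s * total x))) :=
  (BipPairs.expClose_card_disjointFrom hst hM₀ hs ht (fun v => (hH.1 v).trans_le (hx v))
    (fun u => (hH.2 u).trans_le (hy u)) hM).trans
      (expClose_disjointEstimate (hH.abs_sum_edges_sub_le s t))

theorem expClose_BP (hst : total s = total t) (hxy : total x = total y) (hM₀ : 0 < total s)
    (hX₀ : 0 < total x) (hxi : xi s t x y < 1 / 60) :
    ExpClose (122 * (xi s t x y + min (xiS s t x) (xiT s t y))) (BP s t x y) (FHat s t x y) := by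
  have hsA (v) : s v ≤ maxEntry s + maxEntry t := (le_maxEntry s v).trans (Nat.le_add_right _ _)
  have htA (u) : t u ≤ maxEntry s + maxEntry t := (le_maxEntry t u).trans (Nat.le_add_left _ _)
  have hxB (v) : x v ≤ maxEntry x + maxEntry y := (le_maxEntry x v).trans (Nat.le_add_right _ _)
  have hyB (u) : y u ≤ maxEntry x + maxEntry y := (le_maxEntry y u).trans (Nat.le_add_left _ _)
  rw [xi_eq] at hxi ⊢
  generalize maxEntry s + maxEntry t = A at *
  generalize maxEntry x + maxEntry y = B at *
  have hA : 0 ≤ ((A : ℝ) ^ 4 + (A : ℝ) ^ 2 * (B : ℝ) ^ 2) / total s := by positivity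
  have hB : 0 ≤ (B : ℝ) ^ 4 / total x := by positivity
  have hsecond := expClose_card_disjointFrom (H := ∅) (d := 0) hxy hX₀ hxB hyB (by simp [degLeft])
    (by simp [degRight]) (sixty_mul_le_of_div_lt hX₀ (B := 0) (by norm_num; linarith))
  have hfirst : ∀ H ∈ disjointFrom x y ∅, ExpClose _ #(disjointFrom s t H) _ := fun H hH =>
    (mem_filter.1 hH).2.1.expClose_card_disjointFrom hst hM₀ hsA htA hxB hyB
      (sixty_mul_le_of_div_lt hM₀ (by linarith))
  rw [FHat_eq, BP_eq_sum, Nat.cast_sum]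
  rw [sum_empty, zero_div] at hsecond
  refine ((ExpClose.sum hfirst).trans (hsecond.mul_const (disjointEstimate_pos _ _ _).le)).mono
    (mul_pos (disjointEstimate_pos _ _ _) (disjointEstimate_pos _ _ _)).le ?_
  have hmin := min_xiS_xiT_nonneg s x t y
  have hfirst_error : 61 * (B * A + A ^ 2 : ℝ) ^ 2 / total s ≤
      122 * (((A : ℝ) ^ 4 + (A : ℝ) ^ 2 * (B : ℝ) ^ 2) / total s) := by
    rw [← mul_div_assoc]
    refine div_le_div_of_nonneg_right ?_ (Nat.cast_nonneg _)
    linarith [add_sq_le (a := (B * A : ℝ)) (b := A ^ 2), mul_pow (B : ℝ) A 2, pow_mul (A : ℝ) 2 2]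
  have hsecond_error : 61 * (((0 : ℕ) : ℝ) * B + B ^ 2) ^ 2 / total x =
      61 * ((B : ℝ) ^ 4 / total x) := by
    push_cast
    ring
  linarith

end Enumeration

end BipPairs

theorem theorem3p1 :
    ∃ ε C : ℝ, 0 < ε ∧ 0 < C ∧
      ∀ (n m : ℕ) (s : Fin n → ℕ) (t : Fin m → ℕ) (x : Fin n → ℕ) (y : Fin m → ℕ),
        BipPairs.Admissible s t x y →
        BipPairs.xi s t x y < ε →
        ∃ θ : ℝ,
          |θ| ≤ C * (BipPairs.xi s t x y + min (BipPairs.xiS s t x) (BipPairs.xiT s t y)) ∧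
          (BipPairs.BP s t x y : ℝ) = BipPairs.FHat s t x y * Real.exp θ := by
  refine ⟨1 / 60, 122, by norm_num, by norm_num, fun n m s t x y hadm hxi => ?_⟩
  exact (BipPairs.expClose_BP hadm.sum_st hadm.sum_xy (Nat.zero_lt_of_lt hadm.ten_lt_st)
    (Nat.zero_lt_of_lt hadm.ten_lt_xy) hxi).exists_eq_mul_exp (BipPairs.FHat_pos s x t y)
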